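/- Work over $\mathbb Z$ with trivial involution and $\epsilon=-1$; all modules are finitely generated free abelian groups and $P^*=\mathrm{Hom}(P,\mathbb Z)$. For $\rho\in \mathrm{Hom}(M,M^*)$ put $(T\rho)(x)(y)=-\rho(y)(x)$ and let $Q_{-1}(M)=\mathrm{coker}(1-T)$. A skew-quadratic form $(M,\psi)$ is a module $M$ with $\psi\in Q_{-1}(M)$; it is nonsingular if $(1+T)\psi\colon M\to M^*$ is an isomorphism. For a submodule $S\subset M$, $S^\perp$ is its annihilator with respect to $(1+T)\psi$. A Lagrangian is a direct summand $L\subset M$ with $L=L^\perp$ and $\psi|_L=0\in Q_{-1}(L)$. The hyperbolic form $H(P)$ is $P\oplus P^*$ with the class of $((x,f),(y,g))\mapsto f(y)$. A quasi-formation $(M,\psi;L,V)$ is a nonsingular skew-quadratic form $(M,\psi)$ with a Lagrangian $L$ and a direct summand $V\subset M$ of half rank. An isomorphism of quasi-formations is an isometry carrying $L$ to $L'$ and $V$ to $V'$, and stable isomorphism means isomorphism after adding trivial formations $(H(P);P,P^*)$. Let $l_3(\mathbb Z)$ be the abelian monoid (under direct sum) of stable isomorphism classes of quasi-formations modulo the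 congruence generated by $(M,\psi;K,L)\oplus(M,\psi;L,V)\sim(M,\psi;K,V)$ for Lagrangians $K,L$. An element of $l_3(\mathbb Z)$ is elementary if it is represented by $(H(K);K,\{(x,\rho(x)):x\in K\})$ for some module $K$ and some $\rho\in\mathrm{Hom}(K,K^*)$. Let $\mathcal F^{\rm zs}_2(\mathbb Z)$ be the abelian monoid (under direct sum) of skew-quadratic forms modulo the relation $v\sim v'$ if $v\oplus(P,0)\cong v'\oplus(P',0)$ for some modules $P,P'$, and let $b\colon l_3(\mathbb Z)\to\mathcal F^{\rm zs}_2(\mathbb Z)\times\mathcal F^{\rm zs}_2(\mathbb Z)$ be the monoid homomorphism $[M,\psi;L,V]\mapsto([V,\psi|_V],[V^\perp,-\psi|_{V^\perp}])$. Proposition. Every element of $l_3(\mathbb Z)$ is elementary. Moreover, $b$ is an isomorphism of $l_3(\mathbb Z)$ onto the diagonal of $\mathcal F^{\rm zs}_2(\mathbb Z)\times\mathcal F^{\rm zs}_2(\mathbb Z)$; that is, there is a monoid isomorphism $e\colon l_3(\mathbb Z)\to\mathcal F^{\rm zs}_2(\mathbb Z)$ with $b(x)=(e(x),e(x))$ for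 all $x$. -/

import Mathlib

/-
Quadratic forms, quasi-formations and the surgery obstruction monoids `l_{2q+1}(ℤ)`, `ε = (-1)^q`.

The ground ring is `ℤ` with the trivial involution.  Its reduced group
`K̃₁(ℤ) = coker (K₁(ℤ) → K₁(ℤ))` is zero, so a stably free (that is, free) finitely generated
abelian group carries exactly one equivalence class of preferred `s`-bases and every isomorphism
is simple.  Hence based modules are finitely generated free abelian groups, and
"simple form", "simple Lagrangian" and "simple isometry" mean nonsingular form, Lagrangian and
isometry.
-/

open LinearMap (BilinForm)

namespace Surgery

noncomputable section

/-! ### The groups `Q_ε(M)` -/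

section Q

variable (ε : ℤˣ) (M : Type) [AddCommGroup M]

/-- The duality involution `T_ε` on `Hom(M, M^*)`: `(T_ε φ) x y = ε φ y x`. -/
def duality : BilinForm ℤ M →ₗ[ℤ] BilinForm ℤ M where
  toFun φ := (ε : ℤ) • φ.flip
  map_add' φ φ' := by ext x y; simp
  map_smul' c φ := by ext x y; simp; ring

/-- `Q_ε(M) = coker (1 - T_ε)`. -/
abbrev Q : Type := BilinForm ℤ M ⧸ LinearMap.range (LinearMap.id - duality ε M)

variable {M}

/-- The class in `Q_ε(M)` of an asymmetric form. -/
def Q.mk : BilinForm ℤ M →ₗ[ℤ] Q ε M :=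
  Submodule.mkQ (LinearMap.range (LinearMap.id - duality ε M))

variable {ε}

theorem duality_duality (φ : BilinForm ℤ M) : duality ε M (duality ε M φ) = φ := by
  ext x y
  rcases Int.units_eq_one_or ε with h | h <;> simp [duality, h]

/-- The symmetrisation `1 + T_ε : Q_ε(M) → Hom(M, M^*)`. -/
def Q.symm : Q ε M →ₗ[ℤ] BilinForm ℤ M :=
  Submodule.liftQ (LinearMap.range (LinearMap.id - duality ε M))
    (LinearMap.id + duality ε M) (by
      rintro _ ⟨φ, rfl⟩
      simp [duality_duality])

/-- The pull-back `ψ ↦ f^* ψ f` along a homomorphism `f`. -/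
def Q.pullback {N : Type} [AddCommGroup N] (f : N →ₗ[ℤ] M) : Q ε M →ₗ[ℤ] Q ε N :=
  Submodule.mapQ (LinearMap.range (LinearMap.id - duality ε M))
    (LinearMap.range (LinearMap.id - duality ε N))
    { toFun := fun φ => φ.compl₁₂ f f
      map_add' := fun φ φ' => by ext; simp
      map_smul' := fun c φ => by ext; simp } (by
      rintro _ ⟨φ, rfl⟩
      refine ⟨φ.compl₁₂ f f, ?_⟩
      ext x y
      simp [duality])

/-- The orthogonal sum `ψ ⊕ ψ'`. -/
def Q.sum {N : Type} [AddCommGroup N] (ψ : Q ε M) (ψ' : Q ε N) : Q ε (M × N) :=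
  Q.pullback (LinearMap.fst ℤ M N) ψ + Q.pullback (LinearMap.snd ℤ M N) ψ'

theorem Q.mk_surjective (ψ : Q ε M) : ∃ ρ : BilinForm ℤ M, Q.mk ε ρ = ψ :=
  Submodule.mkQ_surjective _ ψ

@[simp] theorem Q.symm_mk (ρ : BilinForm ℤ M) (x y : M) :
    Q.symm (Q.mk ε ρ) x y = ρ x y + ε * ρ y x :=
  rfl

theorem Q.pullback_mk {N : Type} [AddCommGroup N] (f : N →ₗ[ℤ] M) (ρ : BilinForm ℤ M) :
    Q.pullback f (Q.mk ε ρ) = Q.mk ε (ρ.compl₁₂ f f) := by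
  simp [Q.pullback, Q.mk]

@[simp] theorem Q.pullback_pullback {N P : Type} [AddCommGroup N] [AddCommGroup P]
    (f : N →ₗ[ℤ] M) (g : P →ₗ[ℤ] N) (ψ : Q ε M) :
    Q.pullback g (Q.pullback f ψ) = Q.pullback (f ∘ₗ g) ψ := by
  obtain ⟨ρ, rfl⟩ := Q.mk_surjective ψ
  rw [Q.pullback_mk, Q.pullback_mk, Q.pullback_mk]
  rfl

@[simp] theorem Q.pullback_id (ψ : Q ε M) : Q.pullback LinearMap.id ψ = ψ := by
  obtain ⟨ρ, rfl⟩ := Q.mk_surjective ψ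
  rw [Q.pullback_mk]
  rfl

theorem Q.symm_pullback {N : Type} [AddCommGroup N] (f : N →ₗ[ℤ] M) (ψ : Q ε M) (x y : N) :
    Q.symm (Q.pullback f ψ) x y = Q.symm ψ (f x) (f y) := by
  obtain ⟨ρ, rfl⟩ := Q.mk_surjective ψ
  simp [Q.pullback_mk]

@[simp] theorem Q.symm_sum {N : Type} [AddCommGroup N] (ψ : Q ε M) (ψ' : Q ε N) (x y : M × N) :
    Q.symm (Q.sum ψ ψ') x y = Q.symm ψ x.1 y.1 + Q.symm ψ' x.2 y.2 := by
  simp [Q.sum, Q.symm_pullback]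

theorem Q.symm_swap (ψ : Q ε M) (x y : M) : Q.symm ψ x y = ε * Q.symm ψ y x := by
  obtain ⟨ρ, rfl⟩ := Q.mk_surjective ψ
  rcases Int.units_eq_one_or ε with rfl | rfl <;> (simp; try ring)

theorem Q.sum_pullback {N M' N' : Type} [AddCommGroup N] [AddCommGroup M'] [AddCommGroup N']
    (ψ : Q ε M) (ψ' : Q ε N) (f : M' →ₗ[ℤ] M) (g : N' →ₗ[ℤ] N) :
    Q.pullback (f.prodMap g) (Q.sum ψ ψ') = Q.sum (Q.pullback f ψ) (Q.pullback g ψ') := by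
  simp only [Q.sum, map_add, Q.pullback_pullback]
  rfl

theorem Q.sum_comm_pullback {N : Type} [AddCommGroup N] (ψ : Q ε M) (ψ' : Q ε N) :
    Q.pullback (LinearEquiv.prodComm ℤ M N).toLinearMap (Q.sum ψ' ψ) = Q.sum ψ ψ' := by
  simp only [Q.sum, map_add, Q.pullback_pullback]
  rw [add_comm]
  rfl

theorem Q.sum_assoc_pullback {N P : Type} [AddCommGroup N] [AddCommGroup P]
    (ψ : Q ε M) (ψ' : Q ε N) (ψ'' : Q ε P) :
    Q.pullback (LinearEquiv.prodAssoc ℤ M N P).toLinearMap (Q.sum ψ (Q.sum ψ' ψ'')) =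
      Q.sum (Q.sum ψ ψ') ψ'' := by
  simp only [Q.sum, map_add, Q.pullback_pullback]
  rw [← add_assoc]
  rfl

/-- The isomorphism `0 ⊕ M ≅ M`. -/
def punitProd (M : Type) [AddCommGroup M] : (PUnit.{1} × M) ≃ₗ[ℤ] M :=
  LinearEquiv.uniqueProd

theorem Q.zero_sum_pullback (ψ : Q ε M) :
    Q.pullback (punitProd M).toLinearMap ψ = Q.sum (0 : Q ε PUnit.{1}) ψ := by
  simp only [Q.sum, map_zero, zero_add]
  rfl

theorem Q.sum_zero_zero {N : Type} [AddCommGroup N] : Q.sum (0 : Q ε M) (0 : Q ε N) = 0 := by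
  simp [Q.sum]

end Q

/-! ### Forms and `0`-stabilised forms -/

/-- An `ε`-quadratic form `(V, θ)` on a finitely generated free abelian group. -/
structure Form (ε : ℤˣ) where
  carrier : Type
  [grp : AddCommGroup carrier]
  [free : Module.Free ℤ carrier]
  [fin : Module.Finite ℤ carrier]
  θ : Q ε carrier

attribute [instance] Form.grp Form.free Form.fin

namespace Form

variable {ε : ℤˣ}

/-- There is an isometry `v ≅ w`. -/
def Isometric (v w : Form ε) : Prop :=
  ∃ f : v.carrier ≃ₗ[ℤ] w.carrier, Q.pullback f.toLinearMap w.θ = v.θ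

/-- The orthogonal sum of forms. -/
def sum (v w : Form ε) : Form ε where
  carrier := v.carrier × w.carrier
  θ := Q.sum v.θ w.θ

/-- The zero form `(P, 0)`. -/
def zero (ε : ℤˣ) (P : Type) [AddCommGroup P] [Module.Free ℤ P] [Module.Finite ℤ P] : Form ε where
  carrier := P
  θ := 0

theorem Isometric.refl (v : Form ε) : Isometric v v := ⟨LinearEquiv.refl ℤ _, Q.pullback_id _⟩

theorem Isometric.symm {v w : Form ε} : Isometric v w → Isometric w v := by
  rintro ⟨f, hf⟩
  refine ⟨f.symm, ?_⟩
  rw [← hf, Q.pullback_pullback]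
  simp

theorem Isometric.trans {u v w : Form ε} : Isometric u v → Isometric v w → Isometric u w := by
  rintro ⟨f, hf⟩ ⟨g, hg⟩
  refine ⟨f.trans g, ?_⟩
  rw [← hf, ← hg, Q.pullback_pullback]
  rfl

theorem Isometric.sum {v v' w w' : Form ε} :
    Isometric v v' → Isometric w w' → Isometric (v.sum w) (v'.sum w') := by
  rintro ⟨f, hf⟩ ⟨g, hg⟩
  refine ⟨f.prodCongr g, ?_⟩
  have := Q.sum_pullback v'.θ w'.θ f.toLinearMap g.toLinearMap
  rw [hf, hg] at this
  exact this

theorem isometric_sum_comm (v w : Form ε) : Isometric (v.sum w) (w.sum v) := by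
  exact ⟨LinearEquiv.prodComm ℤ v.carrier w.carrier, Q.sum_comm_pullback v.θ w.θ⟩

theorem isometric_sum_assoc (u v w : Form ε) :
    Isometric ((u.sum v).sum w) (u.sum (v.sum w)) := by
  exact ⟨LinearEquiv.prodAssoc ℤ u.carrier v.carrier w.carrier, Q.sum_assoc_pullback u.θ v.θ w.θ⟩

theorem isometric_zero_sum (v : Form ε) : Isometric ((zero ε PUnit).sum v) v := by
  exact ⟨punitProd v.carrier, Q.zero_sum_pullback v.θ⟩

instance isoSetoid (ε : ℤˣ) : Setoid (Form ε) where
  r := Isometric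
  iseqv := ⟨Isometric.refl, Isometric.symm, Isometric.trans⟩

/-- Isometry classes of `ε`-quadratic forms. -/
def IsoClass (ε : ℤˣ) : Type 1 := Quotient (isoSetoid ε)

/-- The isometry class of a form. -/
def isoClass (v : Form ε) : IsoClass ε := Quotient.mk _ v

instance : Add (IsoClass ε) :=
  ⟨Quotient.map₂ Form.sum fun _ _ h _ _ h' => Isometric.sum h h'⟩

instance : Zero (IsoClass ε) := ⟨isoClass (zero ε PUnit)⟩

/-- The monoid of isometry classes under orthogonal sum. -/
instance : AddCommMonoid (IsoClass ε) where
  add_assoc := by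
    rintro ⟨a⟩ ⟨b⟩ ⟨c⟩
    exact Quotient.sound (isometric_sum_assoc a b c)
  zero_add := by
    rintro ⟨a⟩
    exact Quotient.sound (isometric_zero_sum a)
  add_zero := by
    rintro ⟨a⟩
    exact Quotient.sound ((isometric_sum_comm _ _).trans (isometric_zero_sum a))
  add_comm := by
    rintro ⟨a⟩ ⟨b⟩
    exact Quotient.sound (isometric_sum_comm a b)
  nsmul := nsmulRec

theorem isoClass_sum (v w : Form ε) : isoClass (v.sum w) = isoClass v + isoClass w := rfl

theorem isoClass_zero_prod (P P' : Type) [AddCommGroup P] [Module.Free ℤ P] [Module.Finite ℤ P]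
    [AddCommGroup P'] [Module.Free ℤ P'] [Module.Finite ℤ P'] :
    isoClass (zero ε P) + isoClass (zero ε P') = isoClass (zero ε (P × P')) := by
  have h : Q.sum (0 : Q ε P) (0 : Q ε P') = 0 := Q.sum_zero_zero
  exact congrArg isoClass (congrArg (fun θ => (⟨P × P', θ⟩ : Form ε)) h)

/-- `0`-stable equivalence: `v ⊕ (P, 0) ≅ w ⊕ (P', 0)` for some `P` and `P'`. -/
def zeroStable (ε : ℤˣ) : AddCon (IsoClass ε) where
  r a b := ∃ (P P' : Type) (_ : AddCommGroup P) (_ : Module.Free ℤ P) (_ : Module.Finite ℤ P)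
    (_ : AddCommGroup P') (_ : Module.Free ℤ P') (_ : Module.Finite ℤ P'),
    a + isoClass (zero ε P) = b + isoClass (zero ε P')
  iseqv := by
    refine ⟨fun a => ⟨PUnit, PUnit, inferInstance, inferInstance, inferInstance, inferInstance,
      inferInstance, inferInstance, rfl⟩, ?_, ?_⟩
    · rintro a b ⟨P, P', _, _, _, _, _, _, h⟩
      exact ⟨P', P, inferInstance, inferInstance, inferInstance, inferInstance,
        inferInstance, inferInstance, h.symm⟩
    · rintro a b c ⟨P, P', _, _, _, _, _, _, h⟩ ⟨R, R', _, _, _, _, _, _, h'⟩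
      refine ⟨P × R, P' × R', inferInstance, inferInstance, inferInstance, inferInstance,
        inferInstance, inferInstance, ?_⟩
      rw [← isoClass_zero_prod, ← isoClass_zero_prod, ← add_assoc, h, add_right_comm, h']
      abel
  add' := by
    rintro a b c d ⟨P, P', _, _, _, _, _, _, h⟩ ⟨R, R', _, _, _, _, _, _, h'⟩
    refine ⟨P × R, P' × R', inferInstance, inferInstance, inferInstance, inferInstance,
      inferInstance, inferInstance, ?_⟩
    rw [← isoClass_zero_prod, ← isoClass_zero_prod, add_add_add_comm, h, h', add_add_add_comm]

end Form

/-- The monoid `F^{zs}_{2q}(ℤ)` of `0`-stabilised `ε`-quadratic forms, `ε = (-1)^q`. -/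
abbrev FZS (ε : ℤˣ) : Type 1 := (Form.zeroStable ε).Quotient

/-- The `0`-stabilised form `[V, θ]`. -/
def Form.toFZS {ε : ℤˣ} (v : Form ε) : FZS ε := ((v.isoClass : Form.IsoClass ε) : FZS ε)

theorem Form.toFZS_sum {ε : ℤˣ} (v w : Form ε) : (v.sum w).toFZS = v.toFZS + w.toFZS := rfl

theorem Form.toFZS_congr {ε : ℤˣ} {v w : Form ε} (h : Isometric v w) : v.toFZS = w.toFZS :=
  congrArg (fun a : Form.IsoClass ε => (a : FZS ε)) (Quotient.sound h)

theorem Form.toFZS_zero {ε : ℤˣ} (v : Form ε) (h : v.θ = 0) : v.toFZS = 0 := by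
  refine (AddCon.eq _).2 ⟨PUnit, v.carrier, inferInstance, inferInstance, inferInstance,
    inferInstance, inferInstance, inferInstance, ?_⟩
  have h1 : v.isoClass = Form.isoClass (Form.zero ε v.carrier) := by
    obtain ⟨V, θ⟩ := v
    obtain rfl : θ = 0 := h
    rfl
  rw [h1, add_comm]
  rfl

/-! ### Quasi-formations -/

section Sub

variable {ε : ℤˣ} {M : Type} [AddCommGroup M]

/-- The annihilator `L^⊥` of a submodule. -/
def annihilator (ψ : Q ε M) (L : Submodule ℤ M) : Submodule ℤ M where
  carrier := {x | ∀ y ∈ L, Q.symm ψ x y = 0}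
  add_mem' := fun ha hb y hy => by simp [ha y hy, hb y hy]
  zero_mem' := fun y _ => by simp
  smul_mem' := fun c x hx y hy => by simp [hx y hy]

/-- `L` is a direct summand. -/
def IsSummand (L : Submodule ℤ M) : Prop := ∃ L' : Submodule ℤ M, IsCompl L L'

/-- `L` is a Lagrangian: a direct summand with `L = L^⊥` on which the quadratic form vanishes. -/
structure IsLagrangian (ψ : Q ε M) (L : Submodule ℤ M) : Prop where
  summand : IsSummand L
  annihilator_eq : annihilator ψ L = L
  pullback_eq : Q.pullback L.subtype ψ = 0

theorem annihilator_prod {N : Type} [AddCommGroup N] (ψ : Q ε M) (ψ' : Q ε N)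
    (S : Submodule ℤ M) (S' : Submodule ℤ N) :
    annihilator (Q.sum ψ ψ') (S.prod S') = (annihilator ψ S).prod (annihilator ψ' S') := by
  ext ⟨x, x'⟩
  constructor
  · intro h
    constructor
    · intro y hy
      have := h (y, 0) ⟨hy, S'.zero_mem⟩
      simpa using this
    · intro y hy
      have := h (0, y) ⟨S.zero_mem, hy⟩
      simpa using this
  · rintro ⟨h, h'⟩ ⟨y, y'⟩ ⟨hy, hy'⟩
    have h1 : Q.symm ψ x y = 0 := h y hy
    have h2 : Q.symm ψ' x' y' = 0 := h' y' hy'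
    simp [h1, h2]

theorem annihilator_map {N : Type} [AddCommGroup N] (ψ : Q ε N) (f : M ≃ₗ[ℤ] N)
    (S : Submodule ℤ M) :
    annihilator ψ (S.map f.toLinearMap) =
      (annihilator (Q.pullback f.toLinearMap ψ) S).map f.toLinearMap := by
  ext x
  obtain ⟨x, rfl⟩ := f.surjective x
  constructor
  · intro h
    refine ⟨x, fun y hy => ?_, rfl⟩
    rw [Q.symm_pullback]
    exact h _ ⟨y, hy, rfl⟩
  · rintro ⟨z, hz, hzx⟩ _ ⟨y, hy, rfl⟩
    have := hz y hy
    rw [Q.symm_pullback, hzx] at this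
    exact this

theorem IsSummand.prod {N : Type} [AddCommGroup N] {S : Submodule ℤ M} {S' : Submodule ℤ N} :
    IsSummand S → IsSummand S' → IsSummand (S.prod S') := by
  rintro ⟨C, hC⟩ ⟨C', hC'⟩
  refine ⟨C.prod C', ?_, ?_⟩
  · rw [disjoint_iff, Submodule.prod_inf_prod, hC.inf_eq_bot, hC'.inf_eq_bot, Submodule.prod_bot]
  · rw [codisjoint_iff, Submodule.prod_sup_prod, hC.sup_eq_top, hC'.sup_eq_top,
      Submodule.prod_top]

/-- The projections `S ⊕ S' → S` and `S ⊕ S' → S'` form an isomorphism. -/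
def prodSub {N : Type} [AddCommGroup N] (S : Submodule ℤ M) (S' : Submodule ℤ N) :
    (S.prod S') ≃ₗ[ℤ] S × S' where
  toFun x := (⟨x.1.1, x.2.1⟩, ⟨x.1.2, x.2.2⟩)
  invFun y := ⟨(y.1.1, y.2.1), y.1.2, y.2.2⟩
  map_add' _ _ := rfl
  map_smul' _ _ := rfl

theorem pullback_prodSub {N : Type} [AddCommGroup N] (ψ : Q ε M) (ψ' : Q ε N)
    (S : Submodule ℤ M) (S' : Submodule ℤ N) :
    Q.pullback (prodSub S S').toLinearMap
        (Q.sum (Q.pullback S.subtype ψ) (Q.pullback S'.subtype ψ')) =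
      Q.pullback (S.prod S').subtype (Q.sum ψ ψ') := by
  simp only [Q.sum, map_add, Q.pullback_pullback]
  rfl

theorem IsLagrangian.prod {N : Type} [AddCommGroup N] {ψ : Q ε M} {ψ' : Q ε N}
    {S : Submodule ℤ M} {S' : Submodule ℤ N} (h : IsLagrangian ψ S) (h' : IsLagrangian ψ' S') :
    IsLagrangian (Q.sum ψ ψ') (S.prod S') where
  summand := h.summand.prod h'.summand
  annihilator_eq := by rw [annihilator_prod, h.annihilator_eq, h'.annihilator_eq]
  pullback_eq := by
    rw [← pullback_prodSub, h.pullback_eq, h'.pullback_eq, Q.sum_zero_zero, map_zero]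

theorem nonsingular_sum {N : Type} [AddCommGroup N] {ψ : Q ε M} {ψ' : Q ε N}
    (h : Function.Bijective (Q.symm ψ : M →ₗ[ℤ] Module.Dual ℤ M))
    (h' : Function.Bijective (Q.symm ψ' : N →ₗ[ℤ] Module.Dual ℤ N)) :
    Function.Bijective (Q.symm (Q.sum ψ ψ') : M × N →ₗ[ℤ] Module.Dual ℤ (M × N)) := by
  constructor
  · rw [injective_iff_map_eq_zero]
    rintro ⟨x, x'⟩ hx
    have h1 : x = 0 := by
      refine (injective_iff_map_eq_zero _).1 h.1 x (LinearMap.ext fun y => ?_)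
      simpa using LinearMap.congr_fun hx (y, 0)
    have h2 : x' = 0 := by
      refine (injective_iff_map_eq_zero _).1 h'.1 x' (LinearMap.ext fun y => ?_)
      simpa using LinearMap.congr_fun hx (0, y)
    rw [h1, h2]
    rfl
  · intro g
    obtain ⟨x, hx⟩ := h.2 (g ∘ₗ LinearMap.inl ℤ M N)
    obtain ⟨x', hx'⟩ := h'.2 (g ∘ₗ LinearMap.inr ℤ M N)
    refine ⟨(x, x'), LinearMap.ext fun y => ?_⟩
    rw [Q.symm_sum, hx, hx']
    simp only [LinearMap.comp_apply, LinearMap.inl_apply, LinearMap.inr_apply]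
    rw [← map_add]
    simp

theorem IsLagrangian.half_rank [Module.Free ℤ M] [Module.Finite ℤ M] {ψ : Q ε M}
    {L : Submodule ℤ M} (h : IsLagrangian ψ L)
    (hψ : Function.Bijective (Q.symm ψ : M →ₗ[ℤ] Module.Dual ℤ M)) :
    2 * Module.finrank ℤ L = Module.finrank ℤ M := by
  let r : M →ₗ[ℤ] Module.Dual ℤ L := (Module.Dual.transpose L.subtype) ∘ₗ Q.symm ψ
  have hker : LinearMap.ker r = L := by
    refine Eq.trans (Submodule.ext fun x => ?_) h.annihilator_eq
    rw [LinearMap.mem_ker]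
    constructor
    · intro hx y hy
      exact LinearMap.congr_fun hx ⟨y, hy⟩
    · intro hx
      ext ⟨y, hy⟩
      exact hx y hy
  have hsurj : Function.Surjective r := by
    intro g
    obtain ⟨C, hC⟩ := h.summand
    obtain ⟨x, hx⟩ := hψ.2 (g ∘ₗ L.projectionOnto C hC)
    refine ⟨x, LinearMap.ext fun y => ?_⟩
    have := LinearMap.congr_fun hx (y : M)
    change Q.symm ψ x (y : M) = g y
    rw [this]
    simp
  have e := Submodule.finrank_quotient_add_finrank (LinearMap.ker r)
  rw [(r.quotKerEquivOfSurjective hsurj).finrank_eq, hker, Module.finrank_linearMap_self] at e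
  omega

end Sub

/-- An `ε`-quadratic quasi-formation `(M, ψ; L, V)`: a nonsingular `ε`-quadratic form on a finitely
generated free abelian group, a Lagrangian `L` and a half rank direct summand `V`. -/
structure QuasiFormation (ε : ℤˣ) where
  M : Type
  [grp : AddCommGroup M]
  [free : Module.Free ℤ M]
  [fin : Module.Finite ℤ M]
  ψ : Q ε M
  nonsingular : Function.Bijective (Q.symm ψ : M →ₗ[ℤ] Module.Dual ℤ M)
  L : Submodule ℤ M
  lagrangian : IsLagrangian ψ L
  V : Submodule ℤ M
  summand : IsSummand V
  half_rank : 2 * Module.finrank ℤ V = Module.finrank ℤ M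

attribute [instance] QuasiFormation.grp QuasiFormation.free QuasiFormation.fin


/-! ### Hyperbolic forms -/

section Hyperbolic

variable (ε : ℤˣ) (P : Type) [AddCommGroup P]

/-- The asymmetric form `((x, f), (y, g)) ↦ f y` on `P ⊕ P^*`. -/
def hyperbolicPairing : BilinForm ℤ (P × Module.Dual ℤ P) :=
  LinearMap.mk₂ ℤ (fun a b => a.2 b.1) (by simp) (by simp) (by simp) (by simp)

/-- The quadratic structure of the hyperbolic form `H_ε(P)` on `P ⊕ P^*`. -/
def hyperbolic : Q ε (P × Module.Dual ℤ P) := Q.mk ε (hyperbolicPairing P)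

/-- The submodule `P ⊕ 0` of `P ⊕ P^*`. -/
def hypL : Submodule ℤ (P × Module.Dual ℤ P) := (⊤ : Submodule ℤ P).prod ⊥

/-- The submodule `0 ⊕ P^*` of `P ⊕ P^*`. -/
def hypR : Submodule ℤ (P × Module.Dual ℤ P) := (⊥ : Submodule ℤ P).prod ⊤

variable {ε P}

theorem symm_hyperbolic (a b : P × Module.Dual ℤ P) :
    Q.symm (hyperbolic ε P) a b = a.2 b.1 + ε * b.2 a.1 := rfl

theorem hyperbolic_nonsingular [Module.Free ℤ P] [Module.Finite ℤ P] :
    Function.Bijective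
      (Q.symm (hyperbolic ε P) : P × Module.Dual ℤ P →ₗ[ℤ] Module.Dual ℤ (P × Module.Dual ℤ P)) := by
  have hε : (ε : ℤ) * ε = 1 := by rcases Int.units_eq_one_or ε with rfl | rfl <;> simp
  constructor
  · rw [injective_iff_map_eq_zero]
    rintro ⟨x, f⟩ h
    have h1 : f = 0 := by
      ext y
      have := LinearMap.congr_fun h (y, 0)
      rw [symm_hyperbolic] at this
      simpa using this
    have h2 : x = 0 := by
      refine (Module.forall_dual_apply_eq_zero_iff ℤ x).1 fun g => ?_
      have := LinearMap.congr_fun h (0, g)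
      rw [symm_hyperbolic] at this
      simpa using this
    rw [h1, h2]
    rfl
  · intro h
    obtain ⟨x, hx⟩ := (Module.evalEquiv ℤ P).surjective (h ∘ₗ LinearMap.inr ℤ P (Module.Dual ℤ P))
    refine ⟨((ε : ℤ) • x, h ∘ₗ LinearMap.inl ℤ P (Module.Dual ℤ P)), ?_⟩
    refine LinearMap.ext fun b => ?_
    have hb := LinearMap.congr_fun hx b.2
    simp only [Module.evalEquiv_apply, Module.Dual.eval_apply, LinearMap.comp_apply,
      LinearMap.inr_apply] at hb
    rw [symm_hyperbolic]
    simp only [LinearMap.comp_apply, LinearMap.inl_apply, map_smul, smul_eq_mul]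
    rw [← mul_assoc, hε, one_mul, hb, ← map_add]
    simp

theorem isCompl_hyp : IsCompl (hypL P) (hypR P) := by
  constructor
  · rw [Submodule.disjoint_def]
    rintro ⟨x, f⟩ ⟨_, h1⟩ ⟨h2, _⟩
    simp_all
  · rw [codisjoint_iff, eq_top_iff]
    rintro ⟨x, f⟩ -
    refine Submodule.mem_sup.2 ⟨(x, 0), ⟨trivial, rfl⟩, (0, f), ⟨rfl, trivial⟩, by simp⟩

theorem hypL_lagrangian [Module.Free ℤ P] [Module.Finite ℤ P] :
    IsLagrangian (hyperbolic ε P) (hypL P) where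
  summand := ⟨_, isCompl_hyp⟩
  annihilator_eq := by
    ext ⟨x, f⟩
    constructor
    · intro h
      refine ⟨trivial, ?_⟩
      change f = 0
      ext y
      have := h (y, 0) ⟨trivial, rfl⟩
      rw [symm_hyperbolic] at this
      simpa using this
    · rintro ⟨-, h⟩ ⟨y, g⟩ ⟨-, h'⟩
      obtain rfl : f = 0 := h
      obtain rfl : g = 0 := h'
      rw [symm_hyperbolic]
      simp
  pullback_eq := by
    have h0 : (hyperbolicPairing P).compl₁₂ (hypL P).subtype (hypL P).subtype = 0 := by
      ext ⟨⟨x, f⟩, -, h⟩ ⟨⟨y, g⟩, -, h'⟩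
      obtain rfl : f = 0 := h
      rfl
    rw [hyperbolic, Q.pullback_mk, h0, map_zero]

theorem hypR_lagrangian [Module.Free ℤ P] [Module.Finite ℤ P] :
    IsLagrangian (hyperbolic ε P) (hypR P) where
  summand := ⟨_, isCompl_hyp.symm⟩
  annihilator_eq := by
    ext ⟨x, f⟩
    constructor
    · intro h
      refine ⟨?_, trivial⟩
      refine (Module.forall_dual_apply_eq_zero_iff ℤ x).1 fun g => ?_
      have := h (0, g) ⟨rfl, trivial⟩
      rw [symm_hyperbolic] at this
      simpa using this
    · rintro ⟨h, -⟩ ⟨y, g⟩ ⟨h', -⟩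
      obtain rfl : x = 0 := h
      obtain rfl : y = 0 := h'
      rw [symm_hyperbolic]
      simp
  pullback_eq := by
    have h0 : (hyperbolicPairing P).compl₁₂ (hypR P).subtype (hypR P).subtype = 0 := by
      ext ⟨⟨x, f⟩, h, -⟩ ⟨⟨y, g⟩, h', -⟩
      obtain rfl : y = 0 := h'
      change f 0 = 0
      simp
    rw [hyperbolic, Q.pullback_mk, h0, map_zero]

theorem isCompl_graph (ρ : P →ₗ[ℤ] Module.Dual ℤ P) :
    IsCompl (LinearMap.graph ρ) (hypR P) := by
  constructor
  · rw [Submodule.disjoint_def]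
    rintro ⟨x, f⟩ h1 ⟨h2, _⟩
    obtain rfl : x = 0 := h2
    rw [LinearMap.mem_graph_iff] at h1
    simpa using h1
  · rw [codisjoint_iff, eq_top_iff]
    rintro ⟨x, f⟩ -
    refine Submodule.mem_sup.2 ⟨(x, ρ x), by simp, (0, f - ρ x), ⟨rfl, trivial⟩, by simp⟩

theorem finrank_hyp [Module.Free ℤ P] [Module.Finite ℤ P] :
    Module.finrank ℤ (P × Module.Dual ℤ P) = 2 * Module.finrank ℤ P := by
  rw [Module.finrank_prod, Module.finrank_linearMap_self]
  ring

theorem finrank_graph (ρ : P →ₗ[ℤ] Module.Dual ℤ P) :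
    Module.finrank ℤ (LinearMap.graph ρ) = Module.finrank ℤ P := by
  rw [LinearMap.graph_eq_range_prod]
  refine (LinearEquiv.ofInjective (LinearMap.id.prod ρ) fun x y h => ?_).finrank_eq.symm
  exact congrArg Prod.fst h

end Hyperbolic

namespace QuasiFormation

variable {ε : ℤˣ}

/-- There is an isomorphism of quasi-formations `x ≅ y`. -/
def Iso (x y : QuasiFormation ε) : Prop :=
  ∃ f : x.M ≃ₗ[ℤ] y.M, Q.pullback f.toLinearMap y.ψ = x.ψ ∧
    x.L.map f.toLinearMap = y.L ∧ x.V.map f.toLinearMap = y.V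

/-- The direct sum of quasi-formations. -/
def sum (x y : QuasiFormation ε) : QuasiFormation ε where
  M := x.M × y.M
  ψ := Q.sum x.ψ y.ψ
  nonsingular := nonsingular_sum x.nonsingular y.nonsingular
  L := x.L.prod y.L
  lagrangian := x.lagrangian.prod y.lagrangian
  V := x.V.prod y.V
  summand := x.summand.prod y.summand
  half_rank := by
    rw [(prodSub x.V y.V).finrank_eq, Module.finrank_prod, Module.finrank_prod, mul_add,
      x.half_rank, y.half_rank]

/-- The trivial formation `(H_ε(P); P, P^*)`. -/
def trivialFormation (ε : ℤˣ) (P : Type) [AddCommGroup P] [Module.Free ℤ P] [Module.Finite ℤ P] :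
    QuasiFormation ε where
  M := P × Module.Dual ℤ P
  ψ := hyperbolic ε P
  nonsingular := hyperbolic_nonsingular
  L := hypL P
  lagrangian := hypL_lagrangian
  V := hypR P
  summand := (hypR_lagrangian (ε := ε)).summand
  half_rank := (hypR_lagrangian (ε := ε)).half_rank hyperbolic_nonsingular

/-- The boundary `(H_ε(K); K, {(x, ρ x)})` of an asymmetric form `(K, ρ)`. -/
def boundary (ε : ℤˣ) (K : Type) [AddCommGroup K] [Module.Free ℤ K] [Module.Finite ℤ K]
    (ρ : BilinForm ℤ K) : QuasiFormation ε where
  M := K × Module.Dual ℤ K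
  ψ := hyperbolic ε K
  nonsingular := hyperbolic_nonsingular
  L := hypL K
  lagrangian := hypL_lagrangian
  V := LinearMap.graph ρ
  summand := ⟨_, isCompl_graph ρ⟩
  half_rank := by rw [finrank_hyp, finrank_graph]

/-- The quasi-formation `(M, ψ; K, V)` obtained from `x = (M, ψ; L, V)` and a Lagrangian `K`. -/
def replaceL (x : QuasiFormation ε) (K : Submodule ℤ x.M) (hK : IsLagrangian x.ψ K) :
    QuasiFormation ε :=
  { x with L := K, lagrangian := hK }

/-- The formation `(M, ψ; K, L)` obtained from `x = (M, ψ; L, V)` and a Lagrangian `K`. -/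
def formation (x : QuasiFormation ε) (K : Submodule ℤ x.M) (hK : IsLagrangian x.ψ K) :
    QuasiFormation ε :=
  { x with
    L := K
    lagrangian := hK
    V := x.L
    summand := x.lagrangian.summand
    half_rank := x.lagrangian.half_rank x.nonsingular }

theorem Iso.refl (x : QuasiFormation ε) : Iso x x :=
  ⟨LinearEquiv.refl ℤ _, Q.pullback_id _, Submodule.map_id _, Submodule.map_id _⟩

theorem Iso.symm {x y : QuasiFormation ε} : Iso x y → Iso y x := by
  rintro ⟨f, hf, hL, hV⟩
  refine ⟨f.symm, ?_, ?_, ?_⟩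
  · rw [← hf, Q.pullback_pullback]
    simp
  · rw [← hL, ← Submodule.map_comp]
    simp
  · rw [← hV, ← Submodule.map_comp]
    simp

theorem Iso.trans {x y z : QuasiFormation ε} : Iso x y → Iso y z → Iso x z := by
  rintro ⟨f, hf, hL, hV⟩ ⟨g, hg, hL', hV'⟩
  refine ⟨f.trans g, ?_, ?_, ?_⟩
  · rw [← hf, ← hg, Q.pullback_pullback]
    rfl
  · rw [← hL', ← hL, ← Submodule.map_comp]
    rfl
  · rw [← hV', ← hV, ← Submodule.map_comp]
    rfl

theorem map_prodCongr {A B A' B' : Type} [AddCommGroup A] [AddCommGroup B] [AddCommGroup A']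
    [AddCommGroup B'] (f : A ≃ₗ[ℤ] A') (g : B ≃ₗ[ℤ] B') (S : Submodule ℤ A) (S' : Submodule ℤ B) :
    (S.prod S').map (f.prodCongr g).toLinearMap =
      (S.map f.toLinearMap).prod (S'.map g.toLinearMap) := by
  ext ⟨a, b⟩
  constructor
  · rintro ⟨⟨x, y⟩, ⟨hx, hy⟩, h⟩
    cases h
    exact ⟨⟨x, hx, rfl⟩, ⟨y, hy, rfl⟩⟩
  · rintro ⟨⟨x, hx, rfl⟩, ⟨y, hy, rfl⟩⟩
    exact ⟨(x, y), ⟨hx, hy⟩, rfl⟩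

theorem Iso.sum {x x' y y' : QuasiFormation ε} :
    Iso x x' → Iso y y' → Iso (x.sum y) (x'.sum y') := by
  rintro ⟨f, hf, hL, hV⟩ ⟨g, hg, hL', hV'⟩
  refine ⟨f.prodCongr g, ?_, ?_, ?_⟩
  · have := Q.sum_pullback x'.ψ y'.ψ f.toLinearMap g.toLinearMap
    rw [hf, hg] at this
    exact this
  · have := map_prodCongr f g x.L y.L
    rw [hL, hL'] at this
    exact this
  · have := map_prodCongr f g x.V y.V
    rw [hV, hV'] at this
    exact this

theorem map_prodComm {A B : Type} [AddCommGroup A] [AddCommGroup B]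
    (S : Submodule ℤ A) (S' : Submodule ℤ B) :
    (S.prod S').map (LinearEquiv.prodComm ℤ A B).toLinearMap = S'.prod S := by
  ext ⟨a, b⟩
  constructor
  · rintro ⟨⟨x, y⟩, ⟨hx, hy⟩, h⟩
    cases h
    exact ⟨hy, hx⟩
  · rintro ⟨hb, ha⟩
    exact ⟨(b, a), ⟨ha, hb⟩, rfl⟩

theorem map_prodAssoc {A B C : Type} [AddCommGroup A] [AddCommGroup B] [AddCommGroup C]
    (S : Submodule ℤ A) (S' : Submodule ℤ B) (S'' : Submodule ℤ C) :
    ((S.prod S').prod S'').map (LinearEquiv.prodAssoc ℤ A B C).toLinearMap =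
      S.prod (S'.prod S'') := by
  ext ⟨a, b, c⟩
  constructor
  · rintro ⟨⟨⟨x, y⟩, z⟩, ⟨⟨hx, hy⟩, hz⟩, h⟩
    cases h
    exact ⟨hx, hy, hz⟩
  · rintro ⟨ha, hb, hc⟩
    exact ⟨((a, b), c), ⟨⟨ha, hb⟩, hc⟩, rfl⟩

theorem iso_sum_comm (x y : QuasiFormation ε) : Iso (x.sum y) (y.sum x) :=
  ⟨LinearEquiv.prodComm ℤ x.M y.M, Q.sum_comm_pullback x.ψ y.ψ, map_prodComm x.L y.L,
    map_prodComm x.V y.V⟩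

theorem iso_sum_assoc (x y z : QuasiFormation ε) :
    Iso ((x.sum y).sum z) (x.sum (y.sum z)) :=
  ⟨LinearEquiv.prodAssoc ℤ x.M y.M z.M, Q.sum_assoc_pullback x.ψ y.ψ z.ψ,
    map_prodAssoc x.L y.L z.L, map_prodAssoc x.V y.V z.V⟩

/-- Swapping the middle factors of `(P ⊕ P^*) ⊕ (R ⊕ R^*)` gives `(P ⊕ R) ⊕ (P ⊕ R)^*`. -/
def hypProd (P R : Type) [AddCommGroup P] [AddCommGroup R] :
    ((P × Module.Dual ℤ P) × (R × Module.Dual ℤ R)) ≃ₗ[ℤ] ((P × R) × Module.Dual ℤ (P × R)) where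
  toFun a := ((a.1.1, a.2.1), a.1.2.coprod a.2.2)
  invFun b := ((b.1.1, b.2 ∘ₗ LinearMap.inl ℤ P R), (b.1.2, b.2 ∘ₗ LinearMap.inr ℤ P R))
  map_add' a b := by ext <;> simp
  map_smul' c a := by ext <;> simp
  left_inv a := by ext <;> simp
  right_inv b := by ext <;> simp

theorem iso_trivial_sum (P R : Type) [AddCommGroup P] [Module.Free ℤ P] [Module.Finite ℤ P]
    [AddCommGroup R] [Module.Free ℤ R] [Module.Finite ℤ R] :
    Iso ((trivialFormation ε P).sum (trivialFormation ε R)) (trivialFormation ε (P × R)) := by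
  refine ⟨hypProd P R, ?_, ?_, ?_⟩
  · change Q.pullback (hypProd P R).toLinearMap (hyperbolic ε (P × R)) =
      Q.sum (hyperbolic ε P) (hyperbolic ε R)
    simp only [hyperbolic, Q.sum, Q.pullback_mk]
    rw [← map_add]
    congr 1
  · change ((hypL P).prod (hypL R)).map (hypProd P R).toLinearMap = hypL (P × R)
    ext ⟨⟨a, b⟩, f⟩
    constructor
    · rintro ⟨⟨⟨x, g⟩, ⟨y, h⟩⟩, ⟨⟨-, hg⟩, ⟨-, hh⟩⟩, he⟩
      obtain rfl : g = 0 := hg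
      obtain rfl : h = 0 := hh
      refine ⟨trivial, ?_⟩
      have := congrArg Prod.snd he
      rw [← this]
      change LinearMap.coprod 0 0 = 0
      ext <;> simp
    · rintro ⟨-, hf⟩
      obtain rfl : f = 0 := hf
      exact ⟨((a, 0), (b, 0)), ⟨⟨trivial, rfl⟩, ⟨trivial, rfl⟩⟩, by ext <;> simp [hypProd]⟩
  · change ((hypR P).prod (hypR R)).map (hypProd P R).toLinearMap = hypR (P × R)
    ext ⟨⟨a, b⟩, f⟩
    constructor
    · rintro ⟨⟨⟨x, g⟩, ⟨y, h⟩⟩, ⟨⟨hx, -⟩, ⟨hy, -⟩⟩, he⟩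
      obtain rfl : x = 0 := hx
      obtain rfl : y = 0 := hy
      exact ⟨(congrArg Prod.fst he).symm, trivial⟩
    · rintro ⟨h, -⟩
      cases h
      exact ⟨((0, f ∘ₗ LinearMap.inl ℤ P R), (0, f ∘ₗ LinearMap.inr ℤ P R)),
        ⟨⟨rfl, trivial⟩, ⟨rfl, trivial⟩⟩, by ext <;> simp [hypProd]⟩

theorem iso_zero_sum (x : QuasiFormation ε) : Iso ((trivialFormation ε PUnit).sum x) x := by
  have e : Unique (PUnit.{1} × Module.Dual ℤ PUnit.{1}) := by
    refine ⟨⟨0⟩, ?_⟩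
    rintro ⟨a, f⟩
    exact Prod.ext rfl (LinearMap.ext fun y => (map_zero f).trans (map_zero (0 : _ →ₗ[ℤ] ℤ)).symm)
  let f : ((PUnit.{1} × Module.Dual ℤ PUnit.{1}) × x.M) ≃ₗ[ℤ] x.M := LinearEquiv.uniqueProd
  have hmap : ∀ (S : Submodule ℤ (PUnit.{1} × Module.Dual ℤ PUnit.{1})) (S' : Submodule ℤ x.M),
      (S.prod S').map f.toLinearMap = S' := by
    intro S S'
    ext a
    constructor
    · rintro ⟨⟨z, y⟩, ⟨-, hy⟩, h⟩
      cases h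
      exact hy
    · intro ha
      exact ⟨(0, a), ⟨S.zero_mem, ha⟩, rfl⟩
  refine ⟨f, ?_, hmap _ _, hmap _ _⟩
  change Q.pullback f.toLinearMap x.ψ = Q.sum (hyperbolic ε PUnit.{1}) x.ψ
  have h0 : hyperbolic ε PUnit.{1} = 0 := by
    have h1 : hyperbolicPairing PUnit.{1} = 0 := by
      refine LinearMap.ext fun a => LinearMap.ext fun b => ?_
      rw [Subsingleton.elim a 0, map_zero]
      simp
    rw [hyperbolic, h1, map_zero]
  rw [h0]
  simp only [Q.sum, map_zero, zero_add]
  rfl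

instance isoSetoid (ε : ℤˣ) : Setoid (QuasiFormation ε) where
  r := Iso
  iseqv := ⟨Iso.refl, Iso.symm, Iso.trans⟩

/-- Isomorphism classes of quasi-formations. -/
def IsoClass (ε : ℤˣ) : Type 1 := Quotient (isoSetoid ε)

/-- The isomorphism class of a quasi-formation. -/
def isoClass (x : QuasiFormation ε) : IsoClass ε := Quotient.mk _ x

instance : Add (IsoClass ε) :=
  ⟨Quotient.map₂ QuasiFormation.sum fun _ _ h _ _ h' => Iso.sum h h'⟩

instance : Zero (IsoClass ε) := ⟨isoClass (trivialFormation ε PUnit)⟩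

/-- The monoid of isomorphism classes under direct sum. -/
instance : AddCommMonoid (IsoClass ε) where
  add_assoc := by
    rintro ⟨a⟩ ⟨b⟩ ⟨c⟩
    exact Quotient.sound (iso_sum_assoc a b c)
  zero_add := by
    rintro ⟨a⟩
    exact Quotient.sound (iso_zero_sum a)
  add_zero := by
    rintro ⟨a⟩
    exact Quotient.sound ((iso_sum_comm _ _).trans (iso_zero_sum a))
  add_comm := by
    rintro ⟨a⟩ ⟨b⟩
    exact Quotient.sound (iso_sum_comm a b)
  nsmul := nsmulRec

theorem isoClass_trivial_prod (P R : Type) [AddCommGroup P] [Module.Free ℤ P] [Module.Finite ℤ P]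
    [AddCommGroup R] [Module.Free ℤ R] [Module.Finite ℤ R] :
    isoClass (trivialFormation ε P) + isoClass (trivialFormation ε R) =
      isoClass (trivialFormation ε (P × R)) :=
  Quotient.sound (iso_trivial_sum P R)

/-- Stable isomorphism: isomorphism after the addition of trivial formations. -/
def stableIso (ε : ℤˣ) : AddCon (IsoClass ε) where
  r a b := ∃ (P P' : Type) (_ : AddCommGroup P) (_ : Module.Free ℤ P) (_ : Module.Finite ℤ P)
    (_ : AddCommGroup P') (_ : Module.Free ℤ P') (_ : Module.Finite ℤ P'),
    a + isoClass (trivialFormation ε P) = b + isoClass (trivialFormation ε P')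
  iseqv := by
    refine ⟨fun a => ⟨PUnit, PUnit, inferInstance, inferInstance, inferInstance, inferInstance,
      inferInstance, inferInstance, rfl⟩, ?_, ?_⟩
    · rintro a b ⟨P, P', _, _, _, _, _, _, h⟩
      exact ⟨P', P, inferInstance, inferInstance, inferInstance, inferInstance,
        inferInstance, inferInstance, h.symm⟩
    · rintro a b c ⟨P, P', _, _, _, _, _, _, h⟩ ⟨R, R', _, _, _, _, _, _, h'⟩
      refine ⟨P × R, P' × R', inferInstance, inferInstance, inferInstance, inferInstance,
        inferInstance, inferInstance, ?_⟩
      rw [← isoClass_trivial_prod, ← isoClass_trivial_prod, ← add_assoc, h, add_right_comm, h']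
      abel
  add' := by
    rintro a b c d ⟨P, P', _, _, _, _, _, _, h⟩ ⟨R, R', _, _, _, _, _, _, h'⟩
    refine ⟨P × R, P' × R', inferInstance, inferInstance, inferInstance, inferInstance,
      inferInstance, inferInstance, ?_⟩
    rw [← isoClass_trivial_prod, ← isoClass_trivial_prod, add_add_add_comm, h, h',
      add_add_add_comm]

/-- The unital abelian monoid of stable isomorphism classes of quasi-formations. -/
abbrev StableClass (ε : ℤˣ) : Type 1 := (stableIso ε).Quotient

/-- The stable isomorphism class of a quasi-formation. -/
def stableClass (x : QuasiFormation ε) : StableClass ε := ((x.isoClass : IsoClass ε) : StableClass ε)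

/-- The relation `(M, ψ; K, L) ⊕ (M, ψ; L, V) ∼ (M, ψ; K, V)`, where `K` and `L` are
Lagrangians. -/
inductive Shift (ε : ℤˣ) : StableClass ε → StableClass ε → Prop
  | shift (x : QuasiFormation ε) (K : Submodule ℤ x.M) (hK : IsLagrangian x.ψ K) :
      Shift ε (stableClass (x.formation K hK) + stableClass x) (stableClass (x.replaceL K hK))

end QuasiFormation

/-- The monoid `l_{2q+1}(ℤ)`, `ε = (-1)^q`: stable isomorphism classes of `ε`-quadratic
quasi-formations modulo the congruence generated by the shift relation.  In particular
`l_3(ℤ) = LMonoid (-1)`. -/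
abbrev LMonoid (ε : ℤˣ) : Type 1 := (addConGen (QuasiFormation.Shift ε)).Quotient

/-- The class `[x] = [M, ψ; L, V]` of a quasi-formation. -/
def QuasiFormation.toL {ε : ℤˣ} (x : QuasiFormation ε) : LMonoid ε :=
  ((x.stableClass : QuasiFormation.StableClass ε) : LMonoid ε)

/-- An element of `l_{2q+1}(ℤ)` is elementary if it is represented by the boundary of an
asymmetric form. -/
def IsElementary {ε : ℤˣ} (a : LMonoid ε) : Prop :=
  ∃ (K : Type) (_ : AddCommGroup K) (_ : Module.Free ℤ K) (_ : Module.Finite ℤ K)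
    (ρ : BilinForm ℤ K), (QuasiFormation.boundary ε K ρ).toL = a

/-! ### The map `b` -/

section Boundary

variable {ε : ℤˣ}

/-- The form induced on a submodule. -/
def restrict {M : Type} [AddCommGroup M] [Module.Free ℤ M] [Module.Finite ℤ M] (ψ : Q ε M)
    (S : Submodule ℤ M) : Form ε where
  carrier := S
  θ := Q.pullback S.subtype ψ

theorem restrict_isometric {M N : Type} [AddCommGroup M] [Module.Free ℤ M] [Module.Finite ℤ M]
    [AddCommGroup N] [Module.Free ℤ N] [Module.Finite ℤ N] (ψ : Q ε N) (f : M ≃ₗ[ℤ] N)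
    (S : Submodule ℤ M) :
    Form.Isometric (restrict (Q.pullback f.toLinearMap ψ) S)
      (restrict ψ (S.map f.toLinearMap)) := by
  refine ⟨f.submoduleMap S, ?_⟩
  change Q.pullback (f.submoduleMap S).toLinearMap
    (Q.pullback (S.map f.toLinearMap).subtype ψ) = Q.pullback S.subtype (Q.pullback f.toLinearMap ψ)
  rw [Q.pullback_pullback, Q.pullback_pullback]
  rfl

theorem restrict_prod {M N : Type} [AddCommGroup M] [Module.Free ℤ M] [Module.Finite ℤ M]
    [AddCommGroup N] [Module.Free ℤ N] [Module.Finite ℤ N] (ψ : Q ε M) (ψ' : Q ε N)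
    (S : Submodule ℤ M) (S' : Submodule ℤ N) :
    Form.Isometric (restrict (Q.sum ψ ψ') (S.prod S')) ((restrict ψ S).sum (restrict ψ' S')) :=
  ⟨prodSub S S', pullback_prodSub ψ ψ' S S'⟩

namespace QuasiFormation

/-- The form `(V, θ)` induced on `V`. -/
def formV (x : QuasiFormation ε) : Form ε := restrict x.ψ x.V

/-- The form `(V^⊥, -θ^⊥)`: the negative of the form induced on the annihilator of `V`. -/
def formVPerp (x : QuasiFormation ε) : Form ε := restrict (-x.ψ) (annihilator x.ψ x.V)

theorem formV_iso {x y : QuasiFormation ε} : Iso x y → Form.Isometric x.formV y.formV := by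
  rintro ⟨f, hf, -, hV⟩
  have := restrict_isometric y.ψ f x.V
  rwa [hf, hV] at this

theorem formVPerp_iso {x y : QuasiFormation ε} :
    Iso x y → Form.Isometric x.formVPerp y.formVPerp := by
  rintro ⟨f, hf, -, hV⟩
  have := restrict_isometric (-y.ψ) f (annihilator x.ψ x.V)
  rw [map_neg, hf] at this
  have h2 := annihilator_map y.ψ f x.V
  rw [hf, hV] at h2
  rwa [← h2] at this

theorem formV_sum (x y : QuasiFormation ε) :
    (x.sum y).formV.toFZS = x.formV.toFZS + y.formV.toFZS :=
  Form.toFZS_congr (restrict_prod x.ψ y.ψ x.V y.V)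

theorem formVPerp_sum (x y : QuasiFormation ε) :
    (x.sum y).formVPerp.toFZS = x.formVPerp.toFZS + y.formVPerp.toFZS := by
  rw [← Form.toFZS_sum]
  refine Form.toFZS_congr ?_
  have h := restrict_prod (-x.ψ) (-y.ψ) (annihilator x.ψ x.V) (annihilator y.ψ y.V)
  rw [← annihilator_prod] at h
  have h2 : Q.sum (-x.ψ) (-y.ψ) = -Q.sum x.ψ y.ψ := by
    simp only [Q.sum, map_neg, neg_add]
  rw [h2] at h
  exact h

theorem formV_lagrangian (x : QuasiFormation ε) (h : IsLagrangian x.ψ x.V) :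
    x.formV.toFZS = 0 :=
  Form.toFZS_zero _ h.pullback_eq

theorem formVPerp_lagrangian (x : QuasiFormation ε) (h : IsLagrangian x.ψ x.V) :
    x.formVPerp.toFZS = 0 := by
  rw [formVPerp, h.annihilator_eq]
  refine Form.toFZS_zero _ ?_
  have := congrArg Neg.neg h.pullback_eq
  rw [← map_neg, neg_zero] at this
  exact this

/-- The map `x ↦ ([V, θ], [V^⊥, -θ^⊥])` on isomorphism classes. -/
def bIso (ε : ℤˣ) : IsoClass ε →+ FZS ε × FZS ε where
  toFun := Quotient.lift (fun x => (x.formV.toFZS, x.formVPerp.toFZS)) fun _ _ h =>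
    Prod.ext (Form.toFZS_congr (formV_iso h)) (Form.toFZS_congr (formVPerp_iso h))
  map_zero' := Prod.ext (formV_lagrangian _ hypR_lagrangian)
    (formVPerp_lagrangian _ hypR_lagrangian)
  map_add' := by
    rintro ⟨x⟩ ⟨y⟩
    exact Prod.ext (formV_sum x y) (formVPerp_sum x y)

theorem bIso_isoClass (x : QuasiFormation ε) :
    bIso ε x.isoClass = (x.formV.toFZS, x.formVPerp.toFZS) := rfl

theorem bIso_lagrangian (x : QuasiFormation ε) (h : IsLagrangian x.ψ x.V) :
    bIso ε x.isoClass = 0 :=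
  Prod.ext (formV_lagrangian x h) (formVPerp_lagrangian x h)

/-- The map `b` on stable isomorphism classes. -/
def bStable (ε : ℤˣ) : StableClass ε →+ FZS ε × FZS ε :=
  (stableIso ε).lift (bIso ε) (by
    rintro a b ⟨P, P', _, _, _, _, _, _, h⟩
    have := congrArg (bIso ε) h
    rw [map_add, map_add, bIso_lagrangian (trivialFormation ε P) hypR_lagrangian,
      bIso_lagrangian (trivialFormation ε P') hypR_lagrangian, add_zero, add_zero] at this
    exact this)

end QuasiFormation

/-- The monoid map `b : l_{2q+1}(ℤ) → F^{zs}_{2q}(ℤ) × F^{zs}_{2q}(ℤ)`,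
`[M, ψ; L, V] ↦ ([V, θ], [V^⊥, -θ^⊥])`. -/
def b (ε : ℤˣ) : LMonoid ε →+ FZS ε × FZS ε :=
  (addConGen (QuasiFormation.Shift ε)).lift (QuasiFormation.bStable ε) (by
    rw [AddCon.addConGen_le]
    rintro _ _ ⟨x, K, hK⟩
    rw [AddCon.ker_rel, map_add]
    change QuasiFormation.bIso ε (x.formation K hK).isoClass + QuasiFormation.bIso ε x.isoClass =
      QuasiFormation.bIso ε (x.replaceL K hK).isoClass
    rw [QuasiFormation.bIso_lagrangian (x.formation K hK) x.lagrangian, zero_add]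
    rfl)

theorem b_toL (x : QuasiFormation ε) : b ε x.toL = (x.formV.toFZS, x.formVPerp.toFZS) := rfl

end Boundary

end

end Surgery

/-!
The class of a quasi-formation `(M, ψ; L, V)` depends only on the form induced on `V`.

It does not depend on `L`, because `(M, ψ; L, K)` is null for all Lagrangians `L` and `K`. This is
clear when `L` and `K` are complementary, and being null is transitive. So `K` can be moved through
Lagrangians with a common complement until it shares a primitive vector with `L`, by a Euclidean
descent on the coefficient of that vector in a complement of `K`; a hyperbolic plane then splits off
and the rank drops.

Next, `V` has a complementary Lagrangian. It is enough to find an isotropic vector pairing to `1`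
with a vector of `V` and with a vector of `V^⊥`, since reducing along it lowers the rank. If `V` and
`V^⊥` intersect, duality provides one. Otherwise an element of maximal order in the finite group
`M / (V + V^⊥)` prescribes pairings with both at once up to that order, and a Lagrangian supplies
the correction needed at the prime `2`.

Finally, a Lagrangian complement of `V` identifies `(M, ψ)` with `H(V)` in such a way that `V`
becomes the graph of any given representative of `ψ|_V`. Thus the class of `(M, ψ; L, V)` is
elementary, and it is determined by the form on `V`. The annihilator of the graph of `ρ` is the
graph of `-Tρ`, on which `-ψ` is represented by `Tρ`, hence also by `ρ`; so the form on `V^⊥` is the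
same.
-/

namespace Surgery

noncomputable section

/-! ### Primitive vectors and direct summands -/

section Summand

variable {M : Type} [AddCommGroup M]

/-- A vector on which some functional takes the value `1`; over `ℤ` this says that it generates a
free direct summand. -/
def Primitive (x : M) : Prop := ∃ g : Module.Dual ℤ M, g x = 1

theorem IsSummand.exists_extension {V : Submodule ℤ M} (hV : IsSummand V) (g : Module.Dual ℤ V) :
    ∃ g' : Module.Dual ℤ M, ∀ v : V, g' v = g v := by
  obtain ⟨C, hC⟩ := hV
  exact ⟨g ∘ₗ V.projectionOnto C hC, fun v => by simp⟩

theorem IsSummand.comap {N : Type} [AddCommGroup N] {V : Submodule ℤ N} (hV : IsSummand V)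
    (f : M ≃ₗ[ℤ] N) : IsSummand (V.comap f.toLinearMap) := by
  obtain ⟨C, hC⟩ := hV
  exact ⟨C.comap f.toLinearMap, (Submodule.orderIsoMapComap f).symm.isCompl hC⟩

variable [Module.Free ℤ M] [Module.Finite ℤ M]

theorem exists_eq_smul_primitive {x : M} (hx : x ≠ 0) :
    ∃ (c : ℤ) (y : M), Primitive y ∧ x = c • y := by
  let values : Ideal ℤ := LinearMap.range (Module.Dual.eval ℤ M x)
  obtain ⟨c, hc⟩ := (IsPrincipalIdealRing.principal values).principal
  have hdvd (g : Module.Dual ℤ M) : c ∣ g x :=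
    Ideal.mem_span_singleton.1 (hc.le ⟨g, rfl⟩)
  let b := Module.finBasis ℤ M
  choose k hk using fun i => hdvd (b.coord i)
  have hxy : x = c • ∑ i, k i • b i := b.ext_elem fun i => by
    have := hk i
    rw [Module.Basis.coord_apply] at this
    simp [this, Finsupp.single_apply]
  have hc0 : c ≠ 0 := fun h => hx (by rw [hxy, h, zero_smul])
  obtain ⟨g, hg⟩ : c ∈ values := hc ▸ Ideal.mem_span_singleton_self c
  refine ⟨c, _, ⟨g, (mul_eq_left₀ hc0).1 ?_⟩, hxy⟩
  rw [← smul_eq_mul, ← map_smul, ← hxy]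
  exact hg

theorem isSummand_iff_saturated {V : Submodule ℤ M} :
    IsSummand V ↔ ∀ (c : ℤ) (x : M), c ≠ 0 → c • x ∈ V → x ∈ V := by
  constructor
  · rintro ⟨C, hC⟩ c x hc hx
    have h : V.projection C hC (c • x) = c • x := V.projection_apply_left hC ⟨c • x, hx⟩
    rw [map_smul] at h
    rw [← smul_right_injective M hc h]
    exact V.projection_apply_mem hC x
  · intro h
    have : Module.IsTorsionFree ℤ (M ⧸ V) := .of_smul_eq_zero fun c x hx => by
      obtain ⟨x, rfl⟩ := V.mkQ_surjective x
      rw [← map_smul, Submodule.mkQ_apply, Submodule.Quotient.mk_eq_zero] at hx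
      exact or_iff_not_imp_left.2 fun hc => (Submodule.Quotient.mk_eq_zero V).2 (h c x hc hx)
    obtain ⟨s, hs⟩ := Module.projective_lifting_property V.mkQ LinearMap.id V.mkQ_surjective
    let retraction : M →ₗ[ℤ] M := LinearMap.id - s ∘ₗ V.mkQ
    have hmem (x : M) : retraction x ∈ V := by
      have hsx : V.mkQ (s (V.mkQ x)) = V.mkQ x := LinearMap.congr_fun hs _
      rw [← Submodule.Quotient.mk_eq_zero, ← Submodule.mkQ_apply]
      change V.mkQ (x - s (V.mkQ x)) = 0
      rw [map_sub, hsx, sub_self]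
    refine ⟨_, LinearMap.isCompl_of_proj (f := retraction.codRestrict V hmem)
      fun v => Subtype.ext ?_⟩
    change v.1 - s (V.mkQ v.1) = v.1
    rw [Submodule.mkQ_apply, (Submodule.Quotient.mk_eq_zero V).2 v.2, map_zero, sub_zero]

theorem IsSummand.exists_eq_smul_primitive {V : Submodule ℤ M} (hV : IsSummand V) (hV0 : V ≠ ⊥)
    {x : M} (hx : x ∈ V) : ∃ (c : ℤ) (y : M), y ∈ V ∧ Primitive y ∧ x = c • y := by
  have of_ne_zero {x : M} (hx : x ∈ V) (hx0 : x ≠ 0) :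
      ∃ (c : ℤ) (y : M), y ∈ V ∧ Primitive y ∧ x = c • y := by
    obtain ⟨c, y, hy, rfl⟩ := Surgery.exists_eq_smul_primitive hx0
    exact ⟨c, y, isSummand_iff_saturated.1 hV c y (fun h => hx0 (by rw [h, zero_smul])) hx, hy, rfl⟩
  rcases eq_or_ne x 0 with rfl | hx0
  · obtain ⟨z, hz, hz0⟩ := V.ne_bot_iff.1 hV0
    obtain ⟨-, y, hyV, hy, -⟩ := of_ne_zero hz hz0
    exact ⟨0, y, hyV, hy, (zero_smul ℤ y).symm⟩
  · exact of_ne_zero hx hx0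

theorem IsSummand.exists_primitive_mem {V : Submodule ℤ M} (hV : IsSummand V) (hV0 : V ≠ ⊥) :
    ∃ x ∈ V, Primitive x := by
  obtain ⟨-, x, hxV, hx, -⟩ := hV.exists_eq_smul_primitive hV0 V.zero_mem
  exact ⟨x, hxV, hx⟩

end Summand

/-! ### Nonsingular forms -/

section Nonsingular

variable {ε : ℤˣ} {M N : Type} [AddCommGroup M] [AddCommGroup N]

theorem Q.symm_eq_zero_comm (ψ : Q ε M) {x y : M} : Q.symm ψ x y = 0 ↔ Q.symm ψ y x = 0 := by
  rw [Q.symm_swap, mul_eq_zero, or_iff_right ε.ne_zero]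

theorem Q.mk_duality (χ : BilinForm ℤ M) : Q.mk ε (duality ε M χ) = Q.mk ε χ :=
  ((Submodule.Quotient.eq (LinearMap.range (LinearMap.id - duality ε M))).2 ⟨χ, rfl⟩).symm

theorem Q.pullback_add (f g : N →ₗ[ℤ] M) (ψ : Q ε M) :
    Q.pullback (f + g) ψ =
      Q.pullback f ψ + Q.pullback g ψ + Q.mk ε ((Q.symm ψ).compl₁₂ f g) := by
  obtain ⟨ρ, rfl⟩ := Q.mk_surjective ψ
  have hcross : (Q.symm (Q.mk ε ρ)).compl₁₂ f g =
      ρ.compl₁₂ f g + duality ε N (ρ.compl₁₂ g f) := by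
    ext x y
    simp [duality]
  have hexpand : ρ.compl₁₂ (f + g) (f + g) =
      ρ.compl₁₂ f f + ρ.compl₁₂ g g + (ρ.compl₁₂ f g + ρ.compl₁₂ g f) := by
    ext x y
    simp only [LinearMap.compl₁₂_apply, LinearMap.add_apply, map_add]
    ring
  rw [hcross, map_add, Q.mk_duality]
  simp only [Q.pullback_mk, hexpand, map_add]

theorem mem_annihilator {ψ : Q ε M} {S : Submodule ℤ M} {x : M} :
    x ∈ annihilator ψ S ↔ ∀ y ∈ S, Q.symm ψ x y = 0 := Iff.rfl

/-- Nonsingularity of a quadratic form: its symmetrisation `M → M^*` is an isomorphism. -/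
abbrev Nonsingular (ψ : Q ε M) : Prop :=
  Function.Bijective (Q.symm ψ : M →ₗ[ℤ] Module.Dual ℤ M)

namespace Nonsingular

variable {ψ : Q ε M}

theorem exists_symm_eq (h : Nonsingular ψ) (g : Module.Dual ℤ M) :
    ∃ x, ∀ y, Q.symm ψ x y = g y := by
  obtain ⟨x, hx⟩ := h.2 g
  exact ⟨x, fun y => by rw [hx]⟩

theorem eq_zero (h : Nonsingular ψ) {x : M} (hx : ∀ y, Q.symm ψ x y = 0) : x = 0 :=
  h.1 (by rw [map_zero]; exact LinearMap.ext hx)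

theorem exists_symm_eq_on (h : Nonsingular ψ) {V : Submodule ℤ M} (hV : IsSummand V)
    (g : Module.Dual ℤ V) : ∃ x, ∀ v : V, Q.symm ψ x v = g v := by
  obtain ⟨g', hg'⟩ := hV.exists_extension g
  obtain ⟨x, hx⟩ := h.exists_symm_eq g'
  exact ⟨x, fun v => by rw [hx, hg']⟩

theorem exists_symm_eq_one (h : Nonsingular ψ) {x : M} (hx : Primitive x) :
    ∃ y, Q.symm ψ y x = 1 := by
  obtain ⟨g, hg⟩ := hx
  obtain ⟨y, hy⟩ := h.exists_symm_eq g
  exact ⟨y, by rw [hy, hg]⟩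

theorem of_sum {ψ' : Q ε N} (h : Nonsingular (Q.sum ψ ψ')) : Nonsingular ψ' := by
  constructor
  · rw [injective_iff_map_eq_zero]
    intro x hx
    have : ((0, x) : M × N) = 0 := h.eq_zero fun y => by simp [hx]
    exact congrArg Prod.snd this
  · intro g
    obtain ⟨x, hx⟩ := h.exists_symm_eq (g ∘ₗ LinearMap.snd ℤ M N)
    exact ⟨x.2, LinearMap.ext fun y => by simpa using hx (0, y)⟩

theorem pullback (h : Nonsingular ψ) (f : N ≃ₗ[ℤ] M) :
    Nonsingular (Q.pullback f.toLinearMap ψ) := by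
  have hcomp : Q.symm (Q.pullback f.toLinearMap ψ) = f.dualMap ∘ₗ Q.symm ψ ∘ₗ f.toLinearMap := by
    ext x y
    exact Q.symm_pullback _ _ _ _
  rw [Nonsingular, hcomp]
  exact f.dualMap.bijective.comp (h.comp f.bijective)

theorem exists_isometry_sum_annihilator {i : N →ₗ[ℤ] M} (hi : Nonsingular (Q.pullback i ψ)) :
    ∃ φ : (N × annihilator ψ (LinearMap.range i)) ≃ₗ[ℤ] M,
      Q.pullback φ.toLinearMap ψ =
        Q.sum (Q.pullback i ψ) (Q.pullback (annihilator ψ (LinearMap.range i)).subtype ψ) ∧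
      ∀ x, φ (x, 0) = i x := by
  set A := annihilator ψ (LinearMap.range i)
  have horth (x : A) (y : N) : Q.symm ψ x (i y) = 0 := x.2 _ ⟨y, rfl⟩
  have hinj : Function.Injective (i.coprod A.subtype) := by
    rw [injective_iff_map_eq_zero]
    rintro ⟨y, x⟩ hyx
    rw [LinearMap.coprod_apply, Submodule.subtype_apply] at hyx
    have hy : y = 0 := hi.eq_zero fun z => by
      rw [Q.symm_pullback, eq_neg_of_add_eq_zero_left hyx, map_neg, LinearMap.neg_apply, horth,
        neg_zero]
    rw [hy, map_zero, zero_add] at hyx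
    exact Prod.ext hy (Subtype.ext hyx)
  have hsurj : Function.Surjective (i.coprod A.subtype) := fun m => by
    obtain ⟨y, hy⟩ := hi.exists_symm_eq (Q.symm ψ m ∘ₗ i)
    have hm : m - i y ∈ A := by
      rintro _ ⟨z, rfl⟩
      rw [map_sub, LinearMap.sub_apply, ← Q.symm_pullback, hy]
      exact sub_self _
    exact ⟨(y, ⟨_, hm⟩), by simp⟩
  refine ⟨LinearEquiv.ofBijective (i.coprod A.subtype) ⟨hinj, hsurj⟩, ?_, fun x => ?_⟩
  case refine_2 => exact (congrArg (i x + ·) A.subtype.map_zero).trans (add_zero _)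
  have hcross : (Q.symm ψ).compl₁₂ (i ∘ₗ LinearMap.fst ℤ N A) (A.subtype ∘ₗ LinearMap.snd ℤ N A)
      = 0 := LinearMap.ext₂ fun x y => (Q.symm_eq_zero_comm ψ).1 (horth y.2 x.1)
  change Q.pullback (i ∘ₗ LinearMap.fst ℤ N A + A.subtype ∘ₗ LinearMap.snd ℤ N A) ψ = _
  rw [Q.pullback_add, hcross, map_zero, add_zero, Q.sum, Q.pullback_pullback, Q.pullback_pullback]

end Nonsingular

theorem le_annihilator_annihilator (ψ : Q ε M) (V : Submodule ℤ M) :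
    V ≤ annihilator ψ (annihilator ψ V) := fun v hv _ hw =>
  (Q.symm_eq_zero_comm ψ).1 (hw v hv)

theorem isSummand_annihilator [Module.Free ℤ M] [Module.Finite ℤ M] (ψ : Q ε M)
    (V : Submodule ℤ M) : IsSummand (annihilator ψ V) :=
  isSummand_iff_saturated.2 fun c x hc hx y hy => by
    have := hx y hy
    rw [map_smul, LinearMap.smul_apply, smul_eq_mul] at this
    exact (mul_eq_zero.1 this).resolve_left hc

theorem Nonsingular.annihilator_annihilator [Module.Free ℤ M] {ψ : Q ε M} (h : Nonsingular ψ)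
    {V : Submodule ℤ M} (hV : IsSummand V) : annihilator ψ (annihilator ψ V) = V := by
  refine le_antisymm (fun x hx => ?_) (le_annihilator_annihilator ψ V)
  obtain ⟨C, hC⟩ := hV
  refine (Submodule.projection_apply_eq_zero_iff hC.symm).1 <|
    (Module.forall_dual_apply_eq_zero_iff ℤ _).1 fun g => ?_
  obtain ⟨y, hy⟩ := h.exists_symm_eq (g ∘ₗ C.projection V hC.symm)
  have hyV : y ∈ annihilator ψ V := fun v hv => by
    rw [hy, LinearMap.comp_apply, Submodule.projection_apply_of_mem_right hC.symm hv, map_zero]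
  exact (hy x).symm.trans ((Q.symm_eq_zero_comm ψ).1 (hx y hyV))

theorem Nonsingular.finrank_add_finrank_annihilator [Module.Free ℤ M] [Module.Finite ℤ M]
    {ψ : Q ε M} (h : Nonsingular ψ) {V : Submodule ℤ M} (hV : IsSummand V) :
    Module.finrank ℤ V + Module.finrank ℤ (annihilator ψ V) = Module.finrank ℤ M := by
  let r : M →ₗ[ℤ] Module.Dual ℤ V := V.subtype.dualMap ∘ₗ Q.symm ψ
  have hker : LinearMap.ker r = annihilator ψ V := by
    ext x
    rw [LinearMap.mem_ker, mem_annihilator, LinearMap.ext_iff, Subtype.forall]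
    rfl
  have hsurj : Function.Surjective r := fun g => by
    obtain ⟨x, hx⟩ := h.exists_symm_eq_on hV g
    exact ⟨x, LinearMap.ext hx⟩
  rw [← hker, ← r.ker.finrank_quotient_add_finrank,
    (r.quotKerEquivOfSurjective hsurj).finrank_eq, Module.finrank_linearMap_self]

end Nonsingular

/-! ### Lagrangians -/

section Lagrangian

variable {ε : ℤˣ} {M N : Type} [AddCommGroup M] [AddCommGroup N] {ψ : Q ε M}
  {J K V : Submodule ℤ M}

theorem IsSummand.map {V : Submodule ℤ N} (hV : IsSummand V) (f : N ≃ₗ[ℤ] M) :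
    IsSummand (V.map f.toLinearMap) := by
  obtain ⟨C, hC⟩ := hV
  exact ⟨C.map f.toLinearMap, (Submodule.orderIsoMapComap f).isCompl hC⟩

theorem Q.pullback_eq_zero_of_forall_mem {f : N →ₗ[ℤ] M} (hf : ∀ x, f x ∈ K)
    (hK : Q.pullback K.subtype ψ = 0) : Q.pullback f ψ = 0 := by
  rw [← LinearMap.subtype_comp_codRestrict f K hf, ← Q.pullback_pullback, hK, map_zero]

theorem Q.pullback_range_subtype_eq_zero {f : N →ₗ[ℤ] M} (hf : Function.Injective f)
    (hψ : Q.pullback f ψ = 0) : Q.pullback (LinearMap.range f).subtype ψ = 0 := by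
  let e := LinearEquiv.ofInjective f hf
  have hfactor : (LinearMap.range f).subtype = f ∘ₗ e.symm.toLinearMap :=
    LinearMap.ext fun x => (congrArg Subtype.val (e.apply_symm_apply x)).symm
  rw [hfactor, ← Q.pullback_pullback, hψ, map_zero]

namespace IsLagrangian

theorem symm_eq_zero (h : IsLagrangian ψ K) {x y : M} (hx : x ∈ K) (hy : y ∈ K) :
    Q.symm ψ x y = 0 := by
  rw [← h.annihilator_eq] at hx
  exact hx y hy

theorem mem (h : IsLagrangian ψ K) {x : M} (hx : ∀ y ∈ K, Q.symm ψ x y = 0) : x ∈ K := by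
  rw [← h.annihilator_eq]
  exact hx

theorem map {L : Submodule ℤ N} (f : N ≃ₗ[ℤ] M)
    (h : IsLagrangian (Q.pullback f.toLinearMap ψ) L) :
    IsLagrangian ψ (L.map f.toLinearMap) where
  summand := h.summand.map f
  annihilator_eq := by rw [annihilator_map, h.annihilator_eq]
  pullback_eq := by
    have hL := h.pullback_eq
    rw [Q.pullback_pullback] at hL
    rw [← L.range_subtype, ← LinearMap.range_comp]
    exact Q.pullback_range_subtype_eq_zero (f.injective.comp L.subtype_injective) hL

theorem of_isCompl (hψ : Nonsingular ψ) (hK : IsLagrangian ψ K) (hKJ : IsCompl K J)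
    (hJ : Q.pullback J.subtype ψ = 0) : IsLagrangian ψ J where
  summand := ⟨K, hKJ.symm⟩
  annihilator_eq := by
    have hJJ {x y : M} (hx : x ∈ J) (hy : y ∈ J) : Q.symm ψ x y = 0 := by
      have := Q.symm_pullback J.subtype ψ ⟨x, hx⟩ ⟨y, hy⟩
      rw [hJ, map_zero] at this
      exact this.symm
    refine le_antisymm (fun x hx => ?_) fun x hx y hy => hJJ hx hy
    obtain ⟨k, j, hk, hj, rfl⟩ := Submodule.codisjoint_iff_exists_add_eq.1 hKJ.codisjoint x
    have hk0 : k = 0 := hψ.eq_zero fun y => by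
      obtain ⟨k', j', hk', hj', rfl⟩ := Submodule.codisjoint_iff_exists_add_eq.1 hKJ.codisjoint y
      have := hx j' hj'
      rw [map_add, LinearMap.add_apply, hJJ hj hj', add_zero] at this
      rw [map_add, hK.symm_eq_zero hk hk', this, add_zero]
    rwa [hk0, zero_add]
  pullback_eq := hJ

theorem exists_isCompl (hψ : Nonsingular ψ) (hK : IsLagrangian ψ K) :
    ∃ J, IsLagrangian ψ J ∧ IsCompl K J := by
  obtain ⟨C, hC⟩ := hK.summand
  obtain ⟨σ, hσ⟩ := Q.mk_surjective (Q.pullback C.subtype ψ)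
  -- Correcting `C` by `τ : C → K` with `ψ(τ c, c') = -σ(c, c')` cancels the form `σ` on `C`.
  let τ : C →ₗ[ℤ] M := (LinearEquiv.ofBijective (Q.symm ψ) hψ).symm.toLinearMap ∘ₗ
    (C.projectionOnto K hC.symm).dualMap ∘ₗ (-σ)
  have hτ (c : C) (y : M) : Q.symm ψ (τ c) y = -σ c (C.projectionOnto K hC.symm y) :=
    LinearMap.congr_fun ((LinearEquiv.ofBijective (Q.symm ψ) hψ).apply_symm_apply _) y
  have hτK (c : C) : τ c ∈ K := hK.mem fun y hy => by
    rw [hτ, (Submodule.projectionOnto_apply_eq_zero_iff hC.symm).2 hy, map_zero, neg_zero]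
  have hnull : Q.pullback (τ + C.subtype) ψ = 0 := by
    have hcross : (Q.symm ψ).compl₁₂ τ C.subtype = -σ :=
      LinearMap.ext₂ fun c c' => (hτ c c').trans (by simp)
    rw [Q.pullback_add, Q.pullback_eq_zero_of_forall_mem hτK hK.pullback_eq, hcross, map_neg, hσ,
      zero_add, add_neg_cancel]
  have hmem {c : C} (hc : τ c + c ∈ K) : c = 0 :=
    Subtype.ext (hC.disjoint.eq_bot.le ⟨(K.add_mem_iff_right (hτK c)).1 hc, c.2⟩)
  have hinj : Function.Injective (τ + C.subtype) := (injective_iff_map_eq_zero _).2 fun c hc =>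
    hmem (by rw [show τ c + (c : M) = 0 from hc]; exact K.zero_mem)
  have hcompl : IsCompl K (LinearMap.range (τ + C.subtype)) := by
    refine ⟨Submodule.disjoint_def.2 ?_, Submodule.codisjoint_iff_exists_add_eq.2 fun y => ?_⟩
    · rintro _ hK' ⟨c, rfl⟩
      rw [hmem hK', map_zero]
    · obtain ⟨k, c, hk, hc, rfl⟩ := Submodule.codisjoint_iff_exists_add_eq.1 hC.codisjoint y
      refine ⟨k - τ ⟨c, hc⟩, _, K.sub_mem hk (hτK _), ⟨⟨c, hc⟩, rfl⟩, ?_⟩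
      change k - τ ⟨c, hc⟩ + (τ ⟨c, hc⟩ + c) = k + c
      abel
  exact ⟨_, of_isCompl hψ hK hcompl (Q.pullback_range_subtype_eq_zero hinj hnull), hcompl⟩

end IsLagrangian

/-- For `M = V ⊕ J` the map `v + j ↦ (v, ρ v + ψ(j, -)|_V)`. It turns a nonsingular form whose
restriction to `V` is `ρ` and for which `J` is a Lagrangian into the hyperbolic form, carrying `V`
to the graph of `ρ` and `J` to `V^*`. -/
def toHyperbolic (ψ : Q ε M) (hVJ : IsCompl V J) (ρ : BilinForm ℤ V) :
    M →ₗ[ℤ] V × Module.Dual ℤ V :=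
  (V.projectionOnto J hVJ).prod
    (ρ ∘ₗ V.projectionOnto J hVJ + V.subtype.dualMap ∘ₗ Q.symm ψ ∘ₗ J.projection V hVJ.symm)

theorem toHyperbolic_left (hVJ : IsCompl V J) (ρ : BilinForm ℤ V) (v : V) :
    toHyperbolic ψ hVJ ρ v = (v, ρ v) := by
  have hJ : J.projection V hVJ.symm v = 0 := Submodule.projection_apply_of_mem_right hVJ.symm v.2
  simp [toHyperbolic, hJ]

theorem toHyperbolic_right (hVJ : IsCompl V J) (ρ : BilinForm ℤ V) {j : M} (hj : j ∈ J) :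
    toHyperbolic ψ hVJ ρ j = (0, V.subtype.dualMap (Q.symm ψ j)) := by
  have hV : V.projectionOnto J hVJ j = 0 := (Submodule.projectionOnto_apply_eq_zero_iff hVJ).2 hj
  have hJ : J.projection V hVJ.symm j = j := Submodule.projection_apply_left hVJ.symm ⟨j, hj⟩
  simp [toHyperbolic, hV, hJ]

theorem pullback_toHyperbolic (hVJ : IsCompl V J) (hJ : Q.pullback J.subtype ψ = 0)
    {ρ : BilinForm ℤ V} (hρ : Q.mk ε ρ = Q.pullback V.subtype ψ) :
    Q.pullback (toHyperbolic ψ hVJ ρ) (hyperbolic ε V) = ψ := by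
  let pV := V.projectionOnto J hVJ
  let pJ := J.projection V hVJ.symm
  have hpair : (hyperbolicPairing V).compl₁₂ (toHyperbolic ψ hVJ ρ) (toHyperbolic ψ hVJ ρ) =
      ρ.compl₁₂ pV pV + (Q.symm ψ).compl₁₂ pJ (V.subtype ∘ₗ pV) := rfl
  have hid : pJ + V.subtype ∘ₗ pV = LinearMap.id :=
    LinearMap.ext fun m => Submodule.projection_add_projection_eq_self hVJ.symm m
  have hpJ (m : M) : pJ m ∈ J := J.projection_apply_mem hVJ.symm m
  rw [hyperbolic, Q.pullback_mk, hpair, map_add, ← Q.pullback_mk, hρ, Q.pullback_pullback]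
  nth_rw 3 [← Q.pullback_id ψ]
  rw [← hid, Q.pullback_add, Q.pullback_eq_zero_of_forall_mem hpJ hJ, zero_add]

namespace IsLagrangian

theorem exists_isometry_hyperbolic (hψ : Nonsingular ψ) (hJ : IsLagrangian ψ J)
    (hVJ : IsCompl V J) {ρ : BilinForm ℤ V} (hρ : Q.mk ε ρ = Q.pullback V.subtype ψ) :
    ∃ f : M ≃ₗ[ℤ] V × Module.Dual ℤ V, Q.pullback f.toLinearMap (hyperbolic ε V) = ψ ∧
      V.map f.toLinearMap = LinearMap.graph ρ ∧ J.map f.toLinearMap = hypR V := by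
  let F := toHyperbolic ψ hVJ ρ
  have hF_V (v : V) : F v = (v, ρ v) := toHyperbolic_left hVJ ρ v
  have hisom : Q.pullback F (hyperbolic ε V) = ψ := pullback_toHyperbolic hVJ hJ.pullback_eq hρ
  have hinj : Function.Injective F := (injective_iff_map_eq_zero F).2 fun m hm =>
    hψ.eq_zero fun y => by rw [← hisom, Q.symm_pullback, hm, map_zero, LinearMap.zero_apply]
  have hsurj_J (f : Module.Dual ℤ V) : ∃ j ∈ J, F j = (0, f) := by
    obtain ⟨j, hj⟩ := hψ.exists_symm_eq (f ∘ₗ V.projectionOnto J hVJ)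
    have hjJ : j ∈ J := hJ.mem fun y hy => by
      rw [hj, LinearMap.comp_apply, (Submodule.projectionOnto_apply_eq_zero_iff hVJ).2 hy, map_zero]
    refine ⟨j, hjJ, (toHyperbolic_right hVJ ρ hjJ).trans
      (Prod.ext rfl (LinearMap.ext fun v => ?_))⟩
    exact (hj v).trans (congrArg f (Submodule.projectionOnto_apply_left hVJ v))
  have hsurj : Function.Surjective F := by
    rintro ⟨v, f⟩
    obtain ⟨j, -, hj⟩ := hsurj_J (f - ρ v)
    exact ⟨v + j, by rw [map_add, hF_V, hj]; simp⟩
  refine ⟨LinearEquiv.ofBijective F ⟨hinj, hsurj⟩, hisom, ?_, ?_⟩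
  · ext ⟨v, f⟩
    constructor
    · rintro ⟨w, hw, hwv⟩
      obtain ⟨rfl, rfl⟩ := Prod.ext_iff.1 ((hF_V ⟨w, hw⟩).symm.trans hwv)
      rfl
    · intro hf
      obtain rfl : f = ρ v := hf
      exact ⟨v, v.2, hF_V v⟩
  · refine le_antisymm ?_ ?_
    · rintro _ ⟨j, hj, rfl⟩
      exact ⟨congrArg Prod.fst (toHyperbolic_right hVJ ρ hj), trivial⟩
    · rintro ⟨v, f⟩ ⟨rfl, -⟩
      exact hsurj_J f

-- This is the Eichler transvection along `a` and `b`.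
theorem exists_transvection (hK : IsLagrangian ψ K) {a b : M} (ha : a ∈ K) (hb : b ∈ K) :
    ∃ f : M ≃ₗ[ℤ] M, Q.pullback f.toLinearMap ψ = ψ ∧
      ∀ x, f x = x + (Q.symm ψ x a • b - (ε * Q.symm ψ x b) • a) := by
  let g (b : M) : M →ₗ[ℤ] M := ((Q.symm ψ).flip a).smulRight b -
    (ε : ℤ) • ((Q.symm ψ).flip b).smulRight a
  have hg (b x : M) : g b x = Q.symm ψ x a • b - (ε * Q.symm ψ x b) • a := by
    simp [g, mul_smul, smul_comm (ε : ℤ) (Q.symm ψ x b)]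
  have hgK {b : M} (hb : b ∈ K) (x : M) : g b x ∈ K := by
    rw [hg]
    exact K.sub_mem (K.smul_mem _ hb) (K.smul_mem _ ha)
  have hgg {b c : M} (hb : b ∈ K) (hc : c ∈ K) (x : M) : g b (g c x) = 0 := by
    rw [hg, hK.symm_eq_zero (hgK hc x) ha, hK.symm_eq_zero (hgK hc x) hb, mul_zero, zero_smul,
      zero_smul, sub_zero]
  have hneg (x : M) : g (-b) x = -g b x := by
    simp only [hg, map_neg, smul_neg, mul_neg, neg_smul]
    abel
  have hcross : Q.mk ε ((Q.symm ψ).compl₁₂ LinearMap.id (g b)) = 0 := by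
    let χ : BilinForm ℤ M := LinearMap.BilinForm.linMulLin ((Q.symm ψ).flip b) ((Q.symm ψ).flip a)
    have hχ : (Q.symm ψ).compl₁₂ LinearMap.id (g b) = χ - duality ε M χ := by
      ext x y
      simp [χ, hg, duality]
      ring
    rw [hχ, map_sub, Q.mk_duality, sub_self]
  refine ⟨LinearEquiv.ofLinearMap (LinearMap.id + g b) (LinearMap.id + g (-b)) ?_ ?_,
    ?_, fun x => by rw [← hg]; rfl⟩
  · ext x
    simp [hneg, hgg hb hb]
  · ext x
    simp [hneg, hgg hb hb]
  · change Q.pullback (LinearMap.id + g b) ψ = ψ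
    rw [Q.pullback_add, hcross, Q.pullback_id, add_zero,
      Q.pullback_eq_zero_of_forall_mem (hgK hb) hK.pullback_eq, add_zero]

end IsLagrangian

end Lagrangian

/-! ### Formations with trivial class -/

section Null

variable {ε : ℤˣ}

theorem LMonoid.add_zero (a : LMonoid ε) : a + 0 = a :=
  AddMonoid.add_zero (M := LMonoid ε) a

theorem LMonoid.zero_add (a : LMonoid ε) : 0 + a = a :=
  AddMonoid.zero_add (M := LMonoid ε) a

namespace QuasiFormation

theorem toL_sum (x y : QuasiFormation ε) : (x.sum y).toL = x.toL + y.toL := rfl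

theorem Iso.toL_eq {x y : QuasiFormation ε} (h : Iso x y) : x.toL = y.toL :=
  congrArg (fun a : IsoClass ε => ((a : StableClass ε) : LMonoid ε)) (Quotient.sound h)

theorem toL_trivialFormation (P : Type) [AddCommGroup P] [Module.Free ℤ P] [Module.Finite ℤ P] :
    (trivialFormation ε P).toL = 0 := by
  have : (trivialFormation ε P).stableClass = 0 := by
    refine (AddCon.eq _).2 ⟨PUnit, P, inferInstance, inferInstance, inferInstance,
      inferInstance, inferInstance, inferInstance, ?_⟩
    rw [add_comm]
    rfl
  rw [toL, this]
  rfl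

theorem toL_formation_add_toL (x : QuasiFormation ε) (K : Submodule ℤ x.M)
    (hK : IsLagrangian x.ψ K) :
    (x.formation K hK).toL + x.toL = (x.replaceL K hK).toL :=
  (AddCon.eq _).2 (AddConGen.Rel.of _ _ (Shift.shift x K hK))

end QuasiFormation

variable {M N : Type} [AddCommGroup M] [Module.Free ℤ M] [Module.Finite ℤ M]
  [AddCommGroup N] [Module.Free ℤ N] [Module.Finite ℤ N]

/-- The formation `(M, ψ; L, K)` of two Lagrangians represents zero in `LMonoid ε`; in particular
`(M, ψ)` is nonsingular and `L` and `K` are Lagrangians. -/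
def IsNull (ψ : Q ε M) (L K : Submodule ℤ M) : Prop :=
  ∃ (h : Nonsingular ψ) (hL : IsLagrangian ψ L) (hK : IsLagrangian ψ K),
    (QuasiFormation.mk M ψ h L hL K hK.summand (hK.half_rank h)).toL = 0

namespace IsNull

variable {ψ : Q ε M} {ψ' : Q ε N} {L K J : Submodule ℤ M} {L' K' : Submodule ℤ N}

theorem of_isCompl (h : Nonsingular ψ) (hL : IsLagrangian ψ L) (hK : IsLagrangian ψ K)
    (hLK : IsCompl L K) : IsNull ψ L K := by
  obtain ⟨f, hf, hfL, hfK⟩ := hK.exists_isometry_hyperbolic h hLK (ρ := 0)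
    (by rw [map_zero, hL.pullback_eq])
  have hgraph : LinearMap.graph (0 : BilinForm ℤ L) = hypL L := by
    ext ⟨x, g⟩
    simp [hypL, LinearMap.mem_graph_iff]
  refine ⟨h, hL, hK, ?_⟩
  rw [← QuasiFormation.toL_trivialFormation (ε := ε) L]
  exact QuasiFormation.Iso.toL_eq ⟨f, hf, hfL.trans hgraph, hfK⟩

theorem trans (hLK : IsNull ψ L K) (hKJ : IsNull ψ K J) : IsNull ψ L J := by
  obtain ⟨h, hL, hK, hLK⟩ := hLK
  obtain ⟨_, _, hJ, hKJ⟩ := hKJ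
  have hadd := QuasiFormation.toL_formation_add_toL
    (QuasiFormation.mk M ψ h K hK J hJ.summand (hJ.half_rank h)) L hL
  rw [hKJ, LMonoid.add_zero] at hadd
  exact ⟨h, hL, hJ, hadd.symm.trans hLK⟩

theorem refl (h : Nonsingular ψ) (hL : IsLagrangian ψ L) : IsNull ψ L L := by
  obtain ⟨K, hK, hLK⟩ := hL.exists_isCompl h
  exact (of_isCompl h hL hK hLK).trans (of_isCompl h hK hL hLK.symm)

theorem prod (hLK : IsNull ψ L K) (hLK' : IsNull ψ' L' K') :
    IsNull (Q.sum ψ ψ') (L.prod L') (K.prod K') := by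
  obtain ⟨h, hL, hK, hLK⟩ := hLK
  obtain ⟨h', hL', hK', hLK'⟩ := hLK'
  have hsum := QuasiFormation.toL_sum
    (QuasiFormation.mk M ψ h L hL K hK.summand (hK.half_rank h))
    (QuasiFormation.mk N ψ' h' L' hL' K' hK'.summand (hK'.half_rank h'))
  rw [hLK, hLK', LMonoid.add_zero] at hsum
  exact ⟨nonsingular_sum h h', hL.prod hL', hK.prod hK', hsum⟩

theorem map (hψ' : Nonsingular ψ') (f : M ≃ₗ[ℤ] N)
    (hLK : IsNull (Q.pullback f.toLinearMap ψ') L K) :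
    IsNull ψ' (L.map f.toLinearMap) (K.map f.toLinearMap) := by
  obtain ⟨h, hL, hK, hLK⟩ := hLK
  refine ⟨hψ', hL.map f, hK.map f, ?_⟩
  rw [← hLK]
  exact (QuasiFormation.Iso.toL_eq ⟨f, rfl, rfl, rfl⟩).symm

theorem toL_replaceL {x : QuasiFormation ε} {K : Submodule ℤ x.M} (hK : IsLagrangian x.ψ K)
    (h : IsNull x.ψ K x.L) : (x.replaceL K hK).toL = x.toL := by
  obtain ⟨_, _, _, h⟩ := h
  rw [← x.toL_formation_add_toL K hK]
  exact (congrArg (· + x.toL) h).trans (LMonoid.zero_add _)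

end IsNull

end Null

/-! ### Boundaries -/

section Boundary

variable {ε : ℤˣ} {K : Type} [AddCommGroup K]

theorem annihilator_graph (ρ : BilinForm ℤ K) :
    annihilator (hyperbolic ε K) (LinearMap.graph ρ) = LinearMap.graph (-duality ε K ρ) := by
  ext ⟨x, g⟩
  have hsymm (y : K) : Q.symm (hyperbolic ε K) (x, g) (y, ρ y) = g y + duality ε K ρ x y :=
    symm_hyperbolic _ _
  rw [LinearMap.mem_graph_iff, LinearMap.neg_apply, eq_neg_iff_add_eq_zero, LinearMap.ext_iff]
  refine ⟨fun h y => (hsymm y).symm.trans (h (y, ρ y) rfl), ?_⟩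
  rintro h ⟨y, g'⟩ hy
  obtain rfl : g' = ρ y := hy
  exact (hsymm y).trans (h y)

namespace QuasiFormation

variable [Module.Free ℤ K] [Module.Finite ℤ K]

theorem isometric_restrict_graph (ψ : Q ε (K × Module.Dual ℤ K)) (τ : BilinForm ℤ K) :
    Form.Isometric ⟨K, Q.pullback (LinearMap.id.prod τ) ψ⟩ (restrict ψ (LinearMap.graph τ)) := by
  let f : K ≃ₗ[ℤ] LinearMap.graph τ :=
    { (LinearMap.id.prod τ).codRestrict (LinearMap.graph τ) fun _ => rfl with
      invFun := fun x => x.1.1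
      left_inv := fun _ => rfl
      right_inv := fun x => Subtype.ext (Prod.ext rfl x.2.symm) }
  exact ⟨f, Q.pullback_pullback _ _ _⟩

theorem isometric_formV_boundary (ρ : BilinForm ℤ K) :
    Form.Isometric ⟨K, Q.mk ε ρ⟩ (boundary ε K ρ).formV := by
  have := isometric_restrict_graph (hyperbolic ε K) ρ
  rwa [hyperbolic, Q.pullback_mk] at this

theorem isometric_formVPerp_boundary (ρ : BilinForm ℤ K) :
    Form.Isometric ⟨K, Q.mk ε ρ⟩ (boundary ε K ρ).formVPerp := by
  have h := isometric_restrict_graph (-hyperbolic ε K) (-duality ε K ρ)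
  have hρ : Q.pullback (LinearMap.id.prod (-duality ε K ρ)) (-hyperbolic ε K) = Q.mk ε ρ := by
    rw [map_neg, hyperbolic, Q.pullback_mk, ← Q.mk_duality ρ, ← map_neg]
    exact congrArg (Q.mk ε) (neg_neg (duality ε K ρ))
  rw [hρ, ← annihilator_graph] at h
  exact h

theorem b_toL_boundary (ρ : BilinForm ℤ K) : b ε (boundary ε K ρ).toL =
    (Form.toFZS ⟨K, Q.mk ε ρ⟩, Form.toFZS ⟨K, Q.mk ε ρ⟩) := by
  rw [b_toL, Form.toFZS_congr (isometric_formV_boundary ρ).symm,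
    Form.toFZS_congr (isometric_formVPerp_boundary ρ).symm]

theorem boundary_iso {K' : Type} [AddCommGroup K'] [Module.Free ℤ K'] [Module.Finite ℤ K']
    (f : K ≃ₗ[ℤ] K') (ρ : BilinForm ℤ K') :
    Iso (boundary ε K (ρ.compl₁₂ f.toLinearMap f.toLinearMap)) (boundary ε K' ρ) := by
  let F := f.prodCongr f.symm.dualMap
  have hF (x : K) : F (x, ρ.compl₁₂ f.toLinearMap f.toLinearMap x) = (f x, ρ (f x)) :=
    Prod.ext rfl (LinearMap.ext fun y => congrArg (ρ (f x)) (f.apply_symm_apply y))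
  refine ⟨F, ?_, ?_, ?_⟩
  · change Q.pullback F.toLinearMap (hyperbolic ε K') = hyperbolic ε K
    rw [hyperbolic, hyperbolic, Q.pullback_mk]
    refine congrArg (Q.mk ε) (LinearMap.ext₂ fun x y => ?_)
    exact congrArg x.2 (f.symm_apply_apply y.1)
  · change (hypL K).map F.toLinearMap = hypL K'
    rw [hypL, hypL, map_prodCongr, Submodule.map_bot, Submodule.map_top, LinearEquiv.range]
  · change (LinearMap.graph _).map F.toLinearMap = LinearMap.graph ρ
    ext ⟨y, g⟩
    constructor
    · rintro ⟨⟨x, g'⟩, hg', hxy⟩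
      obtain rfl : g' = ρ.compl₁₂ f.toLinearMap f.toLinearMap x := hg'
      rw [← hxy]
      exact congrArg Prod.snd (hF x)
    · intro hg
      obtain rfl : g = ρ y := hg
      exact ⟨(f.symm y, ρ.compl₁₂ f.toLinearMap f.toLinearMap (f.symm y)), rfl,
        (hF _).trans (by rw [f.apply_symm_apply])⟩

end QuasiFormation

end Boundary

/-! ### The quadratic refinement -/

section Quad

variable {M N : Type} [AddCommGroup M] [AddCommGroup N]

/-- The quadratic refinement `x ↦ ρ(x)(x) mod 2` of the skew-quadratic form represented by `ρ`,
as a function of the form for fixed `x`. -/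
def Q.quad (x : M) : Q (-1) M →ₗ[ℤ] ZMod 2 :=
  Submodule.liftQ (LinearMap.range (LinearMap.id - duality (-1) M))
    { toFun := fun ρ => ((ρ x x : ℤ) : ZMod 2)
      map_add' := fun ρ ρ' => by simp
      map_smul' := fun c ρ => by simp } (by
      rintro _ ⟨φ, rfl⟩
      simp [duality, CharTwo.add_self_eq_zero])

@[simp] theorem Q.quad_mk (ρ : BilinForm ℤ M) (x : M) :
    Q.quad x (Q.mk (-1) ρ) = ((ρ x x : ℤ) : ZMod 2) := rfl

theorem Q.symm_neg_swap (ψ : Q (-1) M) (x y : M) : Q.symm ψ x y = -Q.symm ψ y x := by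
  rw [Q.symm_swap, Units.val_neg, Units.val_one, neg_one_mul]

@[simp] theorem Q.symm_self (ψ : Q (-1) M) (x : M) : Q.symm ψ x x = 0 :=
  self_eq_neg.1 (Q.symm_neg_swap ψ x x)

theorem Q.quad_add (ψ : Q (-1) M) (x y : M) :
    Q.quad (x + y) ψ = Q.quad x ψ + Q.quad y ψ + ((Q.symm ψ x y : ℤ) : ZMod 2) := by
  obtain ⟨ρ, rfl⟩ := Q.mk_surjective ψ
  simp [ZModModule.neg_eq_self]
  ring

theorem Q.quad_smul (ψ : Q (-1) M) (c : ℤ) (x : M) :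
    Q.quad (c • x) ψ = (c : ZMod 2) * Q.quad x ψ := by
  obtain ⟨ρ, rfl⟩ := Q.mk_surjective ψ
  have hidem : ∀ a : ZMod 2, a * a = a := by decide
  simp [← mul_assoc, hidem]

theorem Q.quad_add_two_smul (ψ : Q (-1) M) (x y : M) :
    Q.quad (x + (2 : ℤ) • y) ψ = Q.quad x ψ := by
  rw [Q.quad_add, Q.quad_smul, map_smul, smul_eq_mul, Int.cast_mul,
    show ((2 : ℤ) : ZMod 2) = 0 from rfl, zero_mul, zero_mul, add_zero, add_zero]

@[simp] theorem Q.quad_pullback (f : N →ₗ[ℤ] M) (ψ : Q (-1) M) (x : N) :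
    Q.quad x (Q.pullback f ψ) = Q.quad (f x) ψ := by
  obtain ⟨ρ, rfl⟩ := Q.mk_surjective ψ
  simp [Q.pullback_mk]

theorem IsLagrangian.quad_eq_zero {ψ : Q (-1) M} {L : Submodule ℤ M} (hL : IsLagrangian ψ L)
    {x : M} (hx : x ∈ L) : Q.quad x ψ = 0 := by
  have := Q.quad_pullback L.subtype ψ ⟨x, hx⟩
  rwa [hL.pullback_eq, map_zero, eq_comm] at this

theorem Q.pullback_toSpanSingleton_eq_zero {ψ : Q (-1) M} {x : M} (hx : Q.quad x ψ = 0) :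
    Q.pullback (LinearMap.toSpanSingleton ℤ M x) ψ = 0 := by
  obtain ⟨ρ, rfl⟩ := Q.mk_surjective ψ
  obtain ⟨k, hk⟩ := (ZMod.intCast_zmod_eq_zero_iff_dvd _ 2).1 hx
  let χ : BilinForm ℤ ℤ := k • LinearMap.mul ℤ ℤ
  have hχ : ρ.compl₁₂ (LinearMap.toSpanSingleton ℤ M x) (LinearMap.toSpanSingleton ℤ M x) =
      χ - duality (-1) ℤ χ := by
    ext
    simp [χ, duality, hk]
    ring
  rw [Q.pullback_mk, hχ, map_sub, Q.mk_duality, sub_self]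

end Quad

/-! ### Splitting off a hyperbolic plane -/

section Plane

variable {M N : Type} [AddCommGroup M] [AddCommGroup N]

@[simp] theorem Q.pullback_zero {ε : ℤˣ} (ψ : Q ε M) : Q.pullback (0 : N →ₗ[ℤ] M) ψ = 0 := by
  obtain ⟨ρ, rfl⟩ := Q.mk_surjective ψ
  have hρ : LinearMap.compl₁₂ ρ (0 : N →ₗ[ℤ] M) (0 : N →ₗ[ℤ] M) = 0 := by ext; simp
  rw [Q.pullback_mk, hρ, map_zero]

theorem Q.exists_pullback_eq_hyperbolic {ε : ℤˣ} {ψ : Q ε M} {e f : M}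
    (he : Q.pullback (LinearMap.toSpanSingleton ℤ M e) ψ = 0)
    (hf : Q.pullback (LinearMap.toSpanSingleton ℤ M f) ψ = 0) (hfe : Q.symm ψ f e = 1) :
    ∃ i : ℤ × Module.Dual ℤ ℤ →ₗ[ℤ] M, Q.pullback i ψ = hyperbolic ε ℤ ∧ i (1, 0) = e := by
  let ie := LinearMap.toSpanSingleton ℤ M e ∘ₗ LinearMap.fst ℤ ℤ (Module.Dual ℤ ℤ)
  let jf := LinearMap.toSpanSingleton ℤ M f ∘ₗ Module.Dual.eval ℤ ℤ 1 ∘ₗ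
    LinearMap.snd ℤ ℤ (Module.Dual ℤ ℤ)
  have hcross : (Q.symm ψ).compl₁₂ ie jf = duality ε _ (hyperbolicPairing ℤ) := by
    refine LinearMap.ext₂ fun x y => ?_
    change Q.symm ψ (x.1 • e) (y.2 1 • f) = ε * y.2 x.1
    simp only [map_smul, LinearMap.smul_apply, smul_eq_mul, Q.symm_swap ψ e f, hfe]
    rw [← Dual.apply_one_mul_eq y.2 x.1]
    ring
  refine ⟨ie + jf, ?_, by simp [ie, jf]⟩
  rw [Q.pullback_add, hcross, Q.mk_duality, ← Q.pullback_pullback, he, ← Q.pullback_pullback, hf,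
    map_zero, map_zero, add_zero, zero_add, hyperbolic]

namespace Nonsingular

variable {ψ : Q (-1) M}

theorem exists_quad_eq_zero_symm_eq_one (h : Nonsingular ψ) {e : M} (he : Primitive e)
    (hqe : Q.quad e ψ = 0) : ∃ f, Q.quad f ψ = 0 ∧ Q.symm ψ f e = 1 := by
  obtain ⟨f, hf⟩ := h.exists_symm_eq_one he
  have hdichotomy : ∀ a : ZMod 2, a = 0 ∨ a + 1 = 0 := by decide
  rcases hdichotomy (Q.quad f ψ) with hq | hq
  · exact ⟨f, hq, hf⟩
  · exact ⟨f + e, by rw [Q.quad_add, hqe, hf, add_zero, Int.cast_one, hq], by simp [hf]⟩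

theorem exists_plane_splitting [Module.Free ℤ M] [Module.Finite ℤ M] (h : Nonsingular ψ) {e : M}
    (he : Primitive e) (hqe : Q.quad e ψ = 0) :
    ∃ (v : Form (-1)) (φ : ((ℤ × Module.Dual ℤ ℤ) × v.carrier) ≃ₗ[ℤ] M),
      Nonsingular v.θ ∧ Q.pullback φ.toLinearMap ψ = Q.sum (hyperbolic (-1) ℤ) v.θ ∧
      φ ((1, 0), 0) = e := by
  obtain ⟨f, hqf, hfe⟩ := h.exists_quad_eq_zero_symm_eq_one he hqe
  obtain ⟨i, hi, hie⟩ := Q.exists_pullback_eq_hyperbolic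
    (Q.pullback_toSpanSingleton_eq_zero hqe) (Q.pullback_toSpanSingleton_eq_zero hqf) hfe
  have hni : Nonsingular (Q.pullback i ψ) := hi ▸ hyperbolic_nonsingular
  obtain ⟨φ, hφ, hφi⟩ := hni.exists_isometry_sum_annihilator
  have hsplit := h.pullback φ
  rw [hφ] at hsplit
  exact ⟨restrict ψ (annihilator ψ (LinearMap.range i)), φ, hsplit.of_sum, hi ▸ hφ,
    (hφi _).trans hie⟩

end Nonsingular

variable {ε : ℤˣ} {ψ : Q ε M}

theorem mem_hypL {P : Type} [AddCommGroup P] {x : P × Module.Dual ℤ P} :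
    x ∈ hypL P ↔ x.2 = 0 := by
  simp [hypL, Submodule.mem_prod]

namespace IsLagrangian

variable [Module.Free ℤ M] [Module.Finite ℤ M]

theorem of_prod_right {ψ' : Q ε N} {J : Submodule ℤ N} {K : Submodule ℤ M}
    (h : IsLagrangian (Q.sum ψ' ψ) (J.prod K)) : IsLagrangian ψ K := by
  have hann : annihilator ψ K = K := by
    have := congrArg (Submodule.map (LinearMap.snd ℤ N M)) h.annihilator_eq
    rwa [annihilator_prod, Submodule.prod_map_snd, Submodule.prod_map_snd] at this
  refine ⟨hann ▸ isSummand_annihilator ψ K, hann, ?_⟩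
  have := Q.pullback_eq_zero_of_forall_mem (f := LinearMap.inr ℤ N M ∘ₗ K.subtype)
    (fun x => Submodule.mem_prod.2 ⟨J.zero_mem, x.2⟩) h.pullback_eq
  simpa [Q.sum, ← LinearMap.comp_assoc] using this

theorem exists_eq_hypL_prod {L : Submodule ℤ ((ℤ × Module.Dual ℤ ℤ) × M)}
    (hL : IsLagrangian (Q.sum (hyperbolic ε ℤ) ψ) L) (he : ((1, 0), 0) ∈ L) :
    ∃ K, IsLagrangian ψ K ∧ L = (hypL ℤ).prod K := by
  have hsmul (a : ℤ) : (((a, 0), 0) : (ℤ × Module.Dual ℤ ℤ) × M) ∈ L := by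
    simpa using L.smul_mem a he
  have hprod : L = (hypL ℤ).prod (L.comap (LinearMap.inr ℤ (ℤ × Module.Dual ℤ ℤ) M)) := by
    ext ⟨⟨a, g⟩, m⟩
    have hsplit (hg : g = 0) : ((a, g), m) ∈ L ↔ ((0, 0), m) ∈ L := by
      simpa [hg] using L.add_mem_iff_right (y := ((0, 0), m)) (hsmul a)
    constructor
    · intro hx
      have hg : g = 0 := LinearMap.ext_ring (by
        simpa [symm_hyperbolic] using hL.symm_eq_zero hx he)
      exact ⟨mem_hypL.2 hg, (hsplit hg).1 hx⟩
    · rintro ⟨hg, hm⟩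
      exact (hsplit (mem_hypL.1 hg)).2 hm
  exact ⟨_, of_prod_right (hprod ▸ hL), hprod⟩

theorem exists_map_hypL_prod_eq {ψ' : Q ε N} {φ : ((ℤ × Module.Dual ℤ ℤ) × M) ≃ₗ[ℤ] N}
    (hφ : Q.pullback φ.toLinearMap ψ' = Q.sum (hyperbolic ε ℤ) ψ) {L : Submodule ℤ N}
    (hL : IsLagrangian ψ' L) (he : φ ((1, 0), 0) ∈ L) :
    ∃ K, IsLagrangian ψ K ∧ ((hypL ℤ).prod K).map φ.toLinearMap = L := by
  have hback : Q.pullback φ.symm.toLinearMap (Q.sum (hyperbolic ε ℤ) ψ) = ψ' := by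
    rw [← hφ, Q.pullback_pullback, LinearEquiv.comp_symm, Q.pullback_id]
  obtain ⟨K, hK, hLK⟩ := exists_eq_hypL_prod (IsLagrangian.map φ.symm (hback.symm ▸ hL))
    ⟨_, he, φ.symm_apply_apply _⟩
  exact ⟨K, hK, (Submodule.map_symm_eq_iff φ).1 hLK⟩

end IsLagrangian

end Plane

/-! ### Formations of two Lagrangians -/

section Lagrangians

theorem exists_even_mul_abs_sub_mul_lt {c d s : ℤ} (hc : c ≠ 0) (hcd : IsCoprime c d)
    (heven : Even (c * d * s)) : ∃ m, Even (m * s) ∧ |d - c * m| < |c| := by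
  have hpos : 0 < |c| := abs_pos.2 hc
  by_cases hunit : |c| = 1
  · have hcc : c * c = 1 := by rw [← abs_mul_abs_self, hunit, one_mul]
    exact ⟨c * d, heven, by rw [← mul_assoc, hcc, one_mul, sub_self, abs_zero]; exact hpos⟩
  have hdvd : ¬ c ∣ d := fun h => hunit (Int.isUnit_iff_abs_eq.1 (hcd.isUnit_of_dvd' dvd_rfl h))
  -- The remainder of `d` modulo `2 * c` closest to zero.
  have hdiv : (d + |c|) % (2 * c) + 2 * c * ((d + |c|) / (2 * c)) = d + |c| :=
    Int.emod_add_mul_ediv _ _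
  have hnonneg : 0 ≤ (d + |c|) % (2 * c) := Int.emod_nonneg _ (by omega)
  have hlt : (d + |c|) % (2 * c) < 2 * |c| := by
    have := Int.emod_lt_abs (d + |c|) (show 2 * c ≠ 0 by omega)
    rwa [abs_mul, abs_two] at this
  have hne : (d + |c|) % (2 * c) ≠ 0 := fun h => hdvd <| by
    have : c ∣ d + |c| := (Dvd.intro_left 2 rfl).trans (Int.dvd_of_emod_eq_zero h)
    exact (dvd_add_left ((dvd_abs c c).2 dvd_rfl)).1 this
  refine ⟨2 * ((d + |c|) / (2 * c)), by rw [mul_assoc]; exact even_two_mul _, abs_lt.2 ?_⟩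
  constructor <;> linarith [lt_of_le_of_ne hnonneg hne.symm]

theorem IsLagrangian.ne_bot {ε : ℤˣ} {M : Type} [AddCommGroup M] {ψ : Q ε M}
    {K : Submodule ℤ M} (hK : IsLagrangian ψ K) {u : M} (hu : Primitive u) : K ≠ ⊥ := by
  rintro rfl
  obtain ⟨g, hg⟩ := hu
  have : u = 0 := hK.mem fun y hy => by rw [(Submodule.mem_bot ℤ).1 hy, map_zero]
  simp [this] at hg

theorem IsLagrangian.exists_isCompl_add_mem {M : Type} [AddCommGroup M]
    {ψ : Q (-1) M} {K K' : Submodule ℤ M} (hψ : Nonsingular ψ)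
    (hK : IsLagrangian ψ K) (hK' : IsLagrangian ψ K') (hKK' : IsCompl K K') {u z : M}
    (hu : u ∈ K') (hup : Primitive u) (hz : z ∈ K) (heven : Even (Q.symm ψ u z)) :
    ∃ J, IsLagrangian ψ J ∧ IsCompl K J ∧ u + z ∈ J := by
  obtain ⟨f, hfK, hf⟩ : ∃ f ∈ K, Q.symm ψ u f = 1 := by
    obtain ⟨y, hy⟩ := hψ.exists_symm_eq_one hup
    obtain ⟨k, k', hk, hk', rfl⟩ := Submodule.codisjoint_iff_exists_add_eq.1 hKK'.codisjoint y
    rw [map_add, LinearMap.add_apply, hK'.symm_eq_zero hk' hu, add_zero] at hy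
    exact ⟨-k, K.neg_mem hk, by rw [map_neg, ← Q.symm_neg_swap, hy]⟩
  obtain ⟨m, hm⟩ := heven
  obtain ⟨T, hT, hTx⟩ := hK.exists_transvection hfK (K.sub_mem hz (K.smul_mem m hfK))
  have hTu : T u = u + z := by
    simp [hTx, hf, hm]
  have hTK : K.map T.toLinearMap = K := by
    have hfix {x : M} (hx : x ∈ K) : T x = x := by
      simp [hTx, hK.symm_eq_zero hx hfK, hK.symm_eq_zero hx hz]
    ext x
    exact ⟨fun ⟨y, hy, hyx⟩ => hyx ▸ (hfix hy).symm ▸ hy, fun hx => ⟨x, hx, hfix hx⟩⟩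
  refine ⟨K'.map T.toLinearMap, IsLagrangian.map T (hT.symm ▸ hK'), ?_, ⟨u, hu, hTu⟩⟩
  rw [← hTK]
  exact (Submodule.orderIsoMapComap T).isCompl hKK'

theorem exists_isLagrangian_mem_isNull_of_eq_add_smul {M : Type} [AddCommGroup M] [Module.Free ℤ M]
    [Module.Finite ℤ M] {ψ : Q (-1) M} {K K' : Submodule ℤ M} (hψ : Nonsingular ψ)
    (hK : IsLagrangian ψ K) (hK' : IsLagrangian ψ K') (hKK' : IsCompl K K') {x k u : M}
    (hx : Primitive x) (hqx : Q.quad x ψ = 0) (hk : k ∈ K) (hu : u ∈ K') (hup : Primitive u)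
    (c : ℤ) (hxku : x = k + c • u) : ∃ J, IsLagrangian ψ J ∧ x ∈ J ∧ IsNull ψ J K := by
  by_cases hc : c = 0
  · exact ⟨K, hK, by rwa [hxku, hc, zero_smul, add_zero], IsNull.refl hψ hK⟩
  obtain ⟨d, p, hp, hpp, rfl⟩ := hK.summand.exists_eq_smul_primitive (hK.ne_bot hup) hk
  have hcd : IsCoprime c d := by
    obtain ⟨g, hg⟩ := hx
    exact ⟨g u, g p, by rw [← hg, hxku]; simp; ring⟩
  have heven : Even (c * d * Q.symm ψ u p) := by
    have hq : ((d * c * Q.symm ψ p u : ℤ) : ZMod 2) = 0 := by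
      rw [← hqx, hxku, Q.quad_add, hK.quad_eq_zero (K.smul_mem d hp),
        hK'.quad_eq_zero (K'.smul_mem c hu)]
      simp
      ring
    rw [ZMod.intCast_eq_zero_iff_even] at hq
    rw [Q.symm_neg_swap]
    simpa [mul_comm c d] using hq
  obtain ⟨m, hm, _⟩ := exists_even_mul_abs_sub_mul_lt hc hcd heven
  obtain ⟨K'', hK'', hKK'', hmem⟩ := hK.exists_isCompl_add_mem hψ hK' hKK' hu hup
    (K.smul_mem m hp) (by rwa [map_smul, smul_eq_mul])
  obtain ⟨J, hJ, hxJ, hnull⟩ := exists_isLagrangian_mem_isNull_of_eq_add_smul hψ hK'' hK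
    hKK''.symm hx hqx (K''.smul_mem c hmem) hp hpp (d - c * m) (by rw [hxku]; module)
  exact ⟨J, hJ, hxJ, hnull.trans (IsNull.of_isCompl hψ hK'' hK hKK''.symm)⟩
termination_by c.natAbs
decreasing_by zify; assumption

theorem exists_isLagrangian_mem_isNull {M : Type} [AddCommGroup M] [Module.Free ℤ M]
    [Module.Finite ℤ M] {ψ : Q (-1) M} {K : Submodule ℤ M} (hψ : Nonsingular ψ)
    (hK : IsLagrangian ψ K) {x : M} (hx : Primitive x) (hqx : Q.quad x ψ = 0) :
    ∃ J, IsLagrangian ψ J ∧ x ∈ J ∧ IsNull ψ J K := by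
  obtain ⟨K', hK', hKK'⟩ := hK.exists_isCompl hψ
  obtain ⟨k, y, hk, hy, hxky⟩ := Submodule.codisjoint_iff_exists_add_eq.1 hKK'.codisjoint x
  obtain ⟨c, u, hu, hup, rfl⟩ := hK'.summand.exists_eq_smul_primitive (hK'.ne_bot hx) hy
  exact exists_isLagrangian_mem_isNull_of_eq_add_smul hψ hK hK' hKK' hx hqx hk hu hup c hxky.symm

theorem isNull_of_isLagrangian {M : Type} [AddCommGroup M] [Module.Free ℤ M]
    [Module.Finite ℤ M] {ψ : Q (-1) M} {L K : Submodule ℤ M} (hψ : Nonsingular ψ)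
    (hL : IsLagrangian ψ L) (hK : IsLagrangian ψ K) : IsNull ψ L K := by
  by_cases hL0 : L = ⊥
  · have hK0 : K = ⊥ := by
      by_contra hK0
      obtain ⟨x, -, hx⟩ := hK.summand.exists_primitive_mem hK0
      exact hL.ne_bot hx hL0
    exact hL0.trans hK0.symm ▸ IsNull.refl hψ hL
  obtain ⟨x, hxL, hx⟩ := hL.summand.exists_primitive_mem hL0
  obtain ⟨J, hJ, hxJ, hJK⟩ := exists_isLagrangian_mem_isNull hψ hK hx (hL.quad_eq_zero hxL)
  suffices IsNull ψ L J from this.trans hJK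
  obtain ⟨v, φ, hv, hφ, rfl⟩ := hψ.exists_plane_splitting hx (hL.quad_eq_zero hxL)
  obtain ⟨L₁, hL₁, rfl⟩ := hL.exists_map_hypL_prod_eq hφ hxL
  obtain ⟨J₁, hJ₁, rfl⟩ := hJ.exists_map_hypL_prod_eq hφ hxJ
  have : Module.finrank ℤ v.carrier < Module.finrank ℤ M := by
    rw [← φ.finrank_eq, Module.finrank_prod, finrank_hyp, Module.finrank_self]
    omega
  refine IsNull.map hψ φ ?_
  rw [hφ]
  exact (IsNull.refl hyperbolic_nonsingular hypL_lagrangian).prod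
    (isNull_of_isLagrangian hv hL₁ hJ₁)
termination_by Module.finrank ℤ M

end Lagrangians

/-! ### Prescribing functionals up to a multiple -/

section Functionals

variable {X : Type} [AddCommGroup X] [Module.Free ℤ X] [Module.Finite ℤ X]

theorem exists_eq_smul_of_forall_dvd {α : Module.Dual ℤ X} {n : ℤ} (hα : ∀ x, n ∣ α x) :
    ∃ β : Module.Dual ℤ X, α = n • β := by
  choose β hβ using hα
  let b := Module.finBasis ℤ X
  exact ⟨b.constr ℤ fun i => β (b i), b.ext fun i => by simp [hβ (b i)]⟩

theorem exists_add_smul_eq_one (hX : ¬ IsAddCyclic X) {α : Module.Dual ℤ X} (hα : α ≠ 0) {k : ℤ}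
    (hk : ∀ p : ℕ, p.Prime → (p : ℤ) ∣ k → ∃ x, ¬ (p : ℤ) ∣ α x) :
    ∃ (β : Module.Dual ℤ X) (x : X), α x + k * β x = 1 := by
  obtain ⟨c, α₀, ⟨g, hg⟩, rfl⟩ := exists_eq_smul_primitive hα
  obtain ⟨x₀, rfl⟩ := (Module.evalEquiv ℤ X).surjective g
  replace hg : α₀ x₀ = 1 := hg
  obtain ⟨a, b, hab⟩ : IsCoprime c k := by
    rw [Int.isCoprime_iff_gcd_eq_one]
    by_contra hne
    obtain ⟨p, hp, hpd⟩ := Nat.exists_prime_and_dvd hne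
    have hpgcd := Int.natCast_dvd_natCast.2 hpd
    obtain ⟨x, hx⟩ := hk p hp (hpgcd.trans (Int.gcd_dvd_right c k))
    exact hx ((hpgcd.trans (Int.gcd_dvd_left c k)).mul_right _)
  -- As `X` is not cyclic, `α₀` vanishes on some primitive vector `x₁`.
  obtain ⟨y, hy⟩ : ∃ y, y - α₀ y • x₀ ≠ 0 := by
    by_contra! h
    exact hX ⟨x₀, fun y => ⟨α₀ y, (sub_eq_zero.1 (h y)).symm⟩⟩
  obtain ⟨d, x₁, ⟨g, hg₁⟩, hyx₁⟩ := exists_eq_smul_primitive hy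
  have hα₁ : α₀ x₁ = 0 := by
    have hd : d ≠ 0 := fun h => hy (by rw [hyx₁, h, zero_smul])
    have : d * α₀ x₁ = 0 := by
      rw [← smul_eq_mul, ← map_smul, ← hyx₁, map_sub, map_smul, hg, smul_eq_mul, mul_one, sub_self]
    exact (mul_eq_zero.1 this).resolve_left hd
  refine ⟨g - g x₀ • α₀, a • x₀ + b • x₁, ?_⟩
  simp only [map_add, map_smul, LinearMap.sub_apply, LinearMap.smul_apply, hg, hg₁, hα₁,
    smul_eq_mul, mul_one, mul_zero, add_zero]
  linarith

theorem exists_odd_smul_add_two_smul_eq_one (hX : ¬ IsAddCyclic X) {α γ : Module.Dual ℤ X}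
    {a k : ℕ} (hk : Odd k) (hα : ∃ x, ¬ (2 : ℤ) ∣ α x)
    (hγ : ∀ p : ℕ, p.Prime → p ∣ 2 ^ a * k → ∃ x, ¬ (p : ℤ) ∣ γ x) :
    ∃ (β : Module.Dual ℤ X) (x : X),
      k * α x + 2 * γ x + 2 * (2 ^ a * k : ℕ) * β x = 1 := by
  have hodd : ∃ x, ¬ (2 : ℤ) ∣ ((k : ℤ) • α + (2 : ℤ) • γ) x := by
    obtain ⟨x, hx⟩ := hα
    refine ⟨x, ?_⟩
    rw [LinearMap.add_apply, LinearMap.smul_apply, LinearMap.smul_apply, smul_eq_mul, smul_eq_mul,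
      dvd_add_left (dvd_mul_right _ _), Int.prime_two.dvd_mul, not_or]
    exact ⟨mod_cast hk.not_two_dvd_nat, hx⟩
  have hne : (k : ℤ) • α + (2 : ℤ) • γ ≠ 0 := fun h => by
    obtain ⟨x, hx⟩ := hodd
    exact hx (by rw [h]; exact dvd_zero _)
  refine exists_add_smul_eq_one hX hne fun p hp hpk => ?_
  by_cases hp2 : p = 2
  · exact hp2 ▸ hodd
  have hpk' : p ∣ 2 ^ a * k := by
    refine (hp.dvd_mul.1 (show p ∣ 2 * (2 ^ a * k) from mod_cast hpk)).resolve_left fun h => ?_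
    exact hp2 ((Nat.prime_dvd_prime_iff_eq hp Nat.prime_two).1 h)
  have hpdvd : p ∣ k := (hp.dvd_mul.1 hpk').resolve_left fun h =>
    hp2 ((Nat.prime_dvd_prime_iff_eq hp Nat.prime_two).1 (hp.dvd_of_dvd_pow h))
  obtain ⟨x, hx⟩ := hγ p hp hpk'
  refine ⟨x, ?_⟩
  rw [LinearMap.add_apply, LinearMap.smul_apply, LinearMap.smul_apply, smul_eq_mul, smul_eq_mul,
    dvd_add_right ((Int.natCast_dvd_natCast.2 hpdvd).mul_right _),
    (Nat.prime_iff_prime_int.1 hp).dvd_mul, not_or]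
  exact ⟨fun h => hp2 ((Nat.prime_dvd_prime_iff_eq hp Nat.prime_two).1 (mod_cast h)), hx⟩

theorem exists_exponent_of_finrank_eq {S : Submodule ℤ X}
    (hS : Module.finrank ℤ S = Module.finrank ℤ X) :
    ∃ k : ℕ, k ≠ 0 ∧ (∀ x, k • x ∈ S) ∧ ∃ g, ∀ n : ℕ, n • g ∈ S → k ∣ n := by
  have := Submodule.finiteQuotientOfFreeOfRankEq S hS
  have hmem (n : ℕ) (x : X) : n • x ∈ S ↔ n • S.mkQ x = 0 := by
    rw [← map_nsmul, Submodule.mkQ_apply, Submodule.Quotient.mk_eq_zero]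
  have hexp : AddMonoid.ExponentExists (X ⧸ S) := AddMonoid.ExponentExists.of_finite
  obtain ⟨q, hq⟩ := AddMonoid.exists_addOrderOf_eq_exponent hexp
  obtain ⟨g, rfl⟩ := S.mkQ_surjective q
  refine ⟨AddMonoid.exponent (X ⧸ S), hexp.exponent_ne_zero, fun x => (hmem _ x).2 ?_, g,
    fun n hn => ?_⟩
  · exact AddMonoid.exponent_nsmul_eq_zero _
  · exact hq ▸ addOrderOf_dvd_iff_nsmul_eq_zero.2 ((hmem n g).1 hn)

end Functionals

/-! ### Vectors pairing to one with `V` and with its annihilator -/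

section Dual

theorem not_isAddCyclic_of_disjoint_annihilator {M : Type} [AddCommGroup M] {ψ : Q (-1) M}
    {V : Submodule ℤ M} (hV0 : V ≠ ⊥)
    (hV : Disjoint V (annihilator ψ V)) : ¬ IsAddCyclic V := by
  rintro ⟨v, hv⟩
  have hvV : (v : M) ∈ annihilator ψ V := fun y hy => by
    obtain ⟨c, hc⟩ := hv ⟨y, hy⟩
    obtain rfl : c • (v : M) = y := congrArg Subtype.val hc
    simp
  have hv0 : v = 0 := Subtype.ext (Submodule.disjoint_def.1 hV v v.2 hvV)
  refine hV0 ((Submodule.eq_bot_iff V).2 fun y hy => ?_)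
  obtain ⟨c, hc⟩ := hv ⟨y, hy⟩
  simpa [hv0] using (congrArg Subtype.val hc).symm

variable {M : Type} [AddCommGroup M] [Module.Free ℤ M] [Module.Finite ℤ M]

theorem Nonsingular.exists_sub_smul_mem_annihilator {ε : ℤˣ} {ψ : Q ε M} (hψ : Nonsingular ψ)
    {V : Submodule ℤ M} (hV : IsSummand V) {n : ℤ} {x : M} (hx : ∀ v ∈ V, n ∣ Q.symm ψ x v) :
    ∃ y, x - n • y ∈ annihilator ψ V := by
  obtain ⟨β, hβ⟩ := exists_eq_smul_of_forall_dvd (α := Q.symm ψ x ∘ₗ V.subtype)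
    fun v => hx v v.2
  obtain ⟨y, hy⟩ := hψ.exists_symm_eq_on hV β
  refine ⟨y, fun v hv => ?_⟩
  have hxv : Q.symm ψ x v = n * β ⟨v, hv⟩ := LinearMap.congr_fun hβ ⟨v, hv⟩
  rw [map_sub, map_smul, LinearMap.sub_apply, LinearMap.smul_apply, hxv, hy ⟨v, hv⟩, smul_eq_mul,
    sub_self]

theorem Nonsingular.exists_not_dvd_symm {ε : ℤˣ} {ψ : Q ε M} (hψ : Nonsingular ψ)
    {V S : Submodule ℤ M} (hV : IsSummand V) (hVS : annihilator ψ V ≤ S) {k : ℕ} (hk0 : k ≠ 0)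
    (hk : ∀ x, k • x ∈ S) {g : M} (hg : ∀ n : ℕ, n • g ∈ S → k ∣ n) {p : ℕ} (hp : p.Prime)
    (hpk : p ∣ k) : ∃ v : V, ¬ (p : ℤ) ∣ Q.symm ψ g v := by
  by_contra! hdvd
  obtain ⟨y, hy⟩ := hψ.exists_sub_smul_mem_annihilator hV fun v hv => hdvd ⟨v, hv⟩
  obtain ⟨l, rfl⟩ := hpk
  have hmem : l • g ∈ S := by
    have := S.add_mem (S.smul_mem (l : ℤ) (hVS hy)) (hk y)
    convert this using 1
    module
  have hl : l ≠ 0 := right_ne_zero_of_mul hk0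
  exact (Nat.le_of_dvd (Nat.pos_of_ne_zero hl) (hg l hmem)).not_gt
    (lt_mul_of_one_lt_left (Nat.pos_of_ne_zero hl) hp.one_lt)

theorem Nonsingular.exists_symm_eq_mul_on_both {ε : ℤˣ} {ψ : Q ε M} (hψ : Nonsingular ψ)
    {V : Submodule ℤ M} (hV : IsSummand V) {k : ℤ} (hk : ∀ x, k • x ∈ V ⊔ annihilator ψ V)
    (α : Module.Dual ℤ V) (β : Module.Dual ℤ (annihilator ψ V)) :
    ∃ m, (∀ v : V, Q.symm ψ m v = k * α v) ∧ ∀ w : annihilator ψ V, Q.symm ψ m w = k * β w := by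
  obtain ⟨a, ha⟩ := hψ.exists_symm_eq_on hV α
  obtain ⟨b, hb⟩ := hψ.exists_symm_eq_on (isSummand_annihilator ψ V) β
  obtain ⟨v₁, hv₁, w₁, hw₁, hka⟩ := Submodule.mem_sup.1 (hk a)
  obtain ⟨v₂, hv₂, w₂, hw₂, hkb⟩ := Submodule.mem_sup.1 (hk b)
  have horth {v w : M} (hv : v ∈ V) (hw : w ∈ annihilator ψ V) : Q.symm ψ v w = 0 :=
    (Q.symm_eq_zero_comm ψ).1 (hw v hv)
  refine ⟨v₁ + w₂, fun v => ?_, fun w => ?_⟩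
  · have := congrArg (Q.symm ψ · v) hka
    simpa [ha, hw₁ v v.2, hw₂ v v.2] using this
  · have := congrArg (Q.symm ψ · w) hkb
    simpa [hb, horth hv₁ w.2, horth hv₂ w.2] using this

namespace IsLagrangian

variable {ψ : Q (-1) M} {L V : Submodule ℤ M}

theorem quad_eq_zero_of_two_dvd (hL : IsLagrangian ψ L) (hψ : Nonsingular ψ) {x : M}
    (hx : ∀ y ∈ L, 2 ∣ Q.symm ψ x y) : Q.quad x ψ = 0 := by
  obtain ⟨y, hy⟩ := hψ.exists_sub_smul_mem_annihilator hL.summand hx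
  rw [hL.annihilator_eq] at hy
  rw [← sub_add_cancel x ((2 : ℤ) • y), Q.quad_add_two_smul, hL.quad_eq_zero hy]

theorem exists_quad_eq_zero_symm_eq_one (hL : IsLagrangian ψ L) (hψ : Nonsingular ψ) {r : M}
    (hr : Primitive r) : ∃ e, Q.quad e ψ = 0 ∧ Q.symm ψ e r = 1 := by
  by_cases heven : ∀ y ∈ L, 2 ∣ Q.symm ψ r y
  · exact hψ.exists_quad_eq_zero_symm_eq_one hr (hL.quad_eq_zero_of_two_dvd hψ heven)
  push Not at heven
  obtain ⟨x, hx, hxr⟩ := heven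
  rw [Q.symm_neg_swap] at hxr
  obtain ⟨m, hm⟩ : ∃ m, Q.symm ψ x r = 1 - 2 * m := ⟨(1 - Q.symm ψ x r) / 2, by omega⟩
  obtain ⟨y, hy⟩ := hψ.exists_symm_eq_one hr
  refine ⟨x + (2 : ℤ) • m • y, ?_, by simp [hm, hy]⟩
  rw [Q.quad_add_two_smul, hL.quad_eq_zero hx]

theorem exists_odd_on_both_of_two_dvd (hL : IsLagrangian ψ L) (hψ : Nonsingular ψ)
    (hV : IsSummand V) (hV0 : V ≠ ⊥) (heven : ∀ x ∈ L, ∀ v ∈ V, 2 ∣ Q.symm ψ x v) :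
    ∃ e, Q.quad e ψ = 0 ∧ (∃ v ∈ V, ¬ 2 ∣ Q.symm ψ e v) ∧
      ∃ w ∈ annihilator ψ V, ¬ 2 ∣ Q.symm ψ e w := by
  obtain ⟨v, hv, hvp⟩ := hV.exists_primitive_mem hV0
  have hvL : ∀ y ∈ L, 2 ∣ Q.symm ψ v y := fun y hy => by
    rw [Q.symm_neg_swap, dvd_neg]
    exact heven y hy v hv
  have hvV : ∀ u ∈ V, 2 ∣ Q.symm ψ v u := fun u hu => by
    obtain ⟨y, hy⟩ := hψ.exists_sub_smul_mem_annihilator hL.summand hvL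
    rw [hL.annihilator_eq] at hy
    have := heven _ hy u hu
    rw [map_sub, map_smul, LinearMap.sub_apply, LinearMap.smul_apply, smul_eq_mul] at this
    exact (dvd_sub_left (dvd_mul_right _ _)).1 this
  obtain ⟨e, hqe, hev⟩ :=
    hψ.exists_quad_eq_zero_symm_eq_one hvp (hL.quad_eq_zero_of_two_dvd hψ hvL)
  obtain ⟨y, hy⟩ := hψ.exists_sub_smul_mem_annihilator hV hvV
  refine ⟨e, hqe, ⟨v, hv, by rw [hev]; decide⟩, _, hy, ?_⟩
  rw [map_sub, hev, map_smul, smul_eq_mul]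
  omega

theorem exists_odd_on_both (hL : IsLagrangian ψ L) (hψ : Nonsingular ψ) (hV : IsSummand V)
    (hV0 : V ≠ ⊥) (hW0 : annihilator ψ V ≠ ⊥) :
    ∃ e, Q.quad e ψ = 0 ∧ (∃ v ∈ V, ¬ 2 ∣ Q.symm ψ e v) ∧
      ∃ w ∈ annihilator ψ V, ¬ 2 ∣ Q.symm ψ e w := by
  by_cases hLV : ∀ x ∈ L, ∀ v ∈ V, 2 ∣ Q.symm ψ x v
  · exact hL.exists_odd_on_both_of_two_dvd hψ hV hV0 hLV
  by_cases hLW : ∀ x ∈ L, ∀ w ∈ annihilator ψ V, 2 ∣ Q.symm ψ x w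
  · obtain ⟨e, he, heW, heV⟩ :=
      hL.exists_odd_on_both_of_two_dvd hψ (isSummand_annihilator ψ V) hW0 hLW
    rw [hψ.annihilator_annihilator hV] at heV
    exact ⟨e, he, heV, heW⟩
  push Not at hLV hLW
  obtain ⟨x, hx, v, hv, hxv⟩ := hLV
  obtain ⟨y, hy, w, hw, hyw⟩ := hLW
  -- One of `x`, `y` and `x + y` pairs to an odd number with both `v` and `w`.
  by_cases hxw : 2 ∣ Q.symm ψ x w
  · by_cases hyv : 2 ∣ Q.symm ψ y v
    · refine ⟨x + y, hL.quad_eq_zero (L.add_mem hx hy), ⟨v, hv, ?_⟩, w, hw, ?_⟩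
      · rwa [map_add, LinearMap.add_apply, dvd_add_left hyv]
      · rwa [map_add, LinearMap.add_apply, dvd_add_right hxw]
    · exact ⟨y, hL.quad_eq_zero hy, ⟨v, hv, hyv⟩, w, hw, hyw⟩
  · exact ⟨x, hL.quad_eq_zero hx, ⟨v, hv, hxv⟩, w, hw, hxw⟩

theorem exists_dual_on_both_of_disjoint (hL : IsLagrangian ψ L) (hψ : Nonsingular ψ)
    (hV : IsSummand V) (hV0 : V ≠ ⊥) (hW0 : annihilator ψ V ≠ ⊥)
    (hdisj : Disjoint V (annihilator ψ V)) :
    ∃ e, Q.quad e ψ = 0 ∧ (∃ v ∈ V, Q.symm ψ e v = 1) ∧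
      ∃ w ∈ annihilator ψ V, Q.symm ψ e w = 1 := by
  have hW := isSummand_annihilator ψ V
  have hVann := hψ.annihilator_annihilator hV
  obtain ⟨e, hqe, ⟨v, hv, hev⟩, w, hw, hew⟩ := hL.exists_odd_on_both hψ hV hV0 hW0
  have hrank : Module.finrank ℤ ↥(V ⊔ annihilator ψ V) = Module.finrank ℤ M := by
    rw [Submodule.sup_eq_range, LinearMap.finrank_range_of_inj, Module.finrank_prod,
      hψ.finrank_add_finrank_annihilator hV]
    rw [← LinearMap.ker_eq_bot, LinearMap.ker_coprod_of_disjoint_range, Submodule.ker_subtype,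
      Submodule.ker_subtype, Submodule.prod_bot]
    rwa [Submodule.range_subtype, Submodule.range_subtype]
  obtain ⟨k, hk0, hk, g, hg⟩ := exists_exponent_of_finrank_eq hrank
  obtain ⟨a, k', hk', rfl⟩ := Nat.exists_eq_two_pow_mul_odd hk0
  have hgV (p : ℕ) (hp : p.Prime) (hpk : p ∣ 2 ^ a * k') := hψ.exists_not_dvd_symm hV
    le_sup_right hk0 hk hg hp hpk
  have hgW (p : ℕ) (hp : p.Prime) (hpk : p ∣ 2 ^ a * k') := hψ.exists_not_dvd_symm hW
    (hVann.trans_le le_sup_left) hk0 hk hg hp hpk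
  obtain ⟨α, v', hαv⟩ := exists_odd_smul_add_two_smul_eq_one
    (not_isAddCyclic_of_disjoint_annihilator hV0 hdisj) (α := Q.symm ψ e ∘ₗ V.subtype)
    (γ := Q.symm ψ g ∘ₗ V.subtype) hk' ⟨⟨v, hv⟩, hev⟩ hgV
  have hdisj' : Disjoint (annihilator ψ V) (annihilator ψ (annihilator ψ V)) := by
    rw [hVann]
    exact hdisj.symm
  obtain ⟨β, w', hβw⟩ := exists_odd_smul_add_two_smul_eq_one
    (not_isAddCyclic_of_disjoint_annihilator hW0 hdisj')
    (α := Q.symm ψ e ∘ₗ (annihilator ψ V).subtype)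
    (γ := Q.symm ψ g ∘ₗ (annihilator ψ V).subtype) hk' ⟨⟨w, hw⟩, hew⟩ hgW
  obtain ⟨m, hmV, hmW⟩ := hψ.exists_symm_eq_mul_on_both hV (fun x => by
    rw [natCast_zsmul]; exact hk x) α β
  refine ⟨(k' : ℤ) • e + (2 : ℤ) • (g + m), ?_, ⟨v', v'.2, ?_⟩, w', w'.2, ?_⟩
  · rw [Q.quad_add_two_smul, Q.quad_smul, hqe, mul_zero]
  · simpa [hmV, mul_add, mul_assoc, add_assoc] using hαv
  · simpa [hmW, mul_add, mul_assoc, add_assoc] using hβw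

theorem exists_dual_on_both (hL : IsLagrangian ψ L) (hψ : Nonsingular ψ)
    (hV : IsSummand V) (hV0 : V ≠ ⊥) (hW0 : annihilator ψ V ≠ ⊥) :
    ∃ e, Q.quad e ψ = 0 ∧ (∃ v ∈ V, Q.symm ψ e v = 1) ∧
      ∃ w ∈ annihilator ψ V, Q.symm ψ e w = 1 := by
  by_cases hdisj : Disjoint V (annihilator ψ V)
  · exact hL.exists_dual_on_both_of_disjoint hψ hV hV0 hW0 hdisj
  have hinf : IsSummand (V ⊓ annihilator ψ V) := isSummand_iff_saturated.2 fun c x hc hx =>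
    ⟨isSummand_iff_saturated.1 hV c x hc hx.1,
      isSummand_iff_saturated.1 (isSummand_annihilator ψ V) c x hc hx.2⟩
  obtain ⟨r, ⟨hrV, hrW⟩, hr⟩ := hinf.exists_primitive_mem fun h => hdisj (disjoint_iff.2 h)
  obtain ⟨e, he, her⟩ := hL.exists_quad_eq_zero_symm_eq_one hψ hr
  exact ⟨e, he, ⟨r, hrV, her⟩, r, hrW, her⟩

end IsLagrangian

end Dual

/-! ### Lagrangian complements of half rank summands -/

section PlaneReduction

variable {N : Type} [AddCommGroup N] (V : Submodule ℤ ((ℤ × Module.Dual ℤ ℤ) × N))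

/-- The projection to `N` of the part of `V` in `(ℤ ⊕ 0) ⊕ N`: the symplectic reduction of `V`
along the line `ℤ ⊕ 0` of the hyperbolic plane. -/
def planeReduction : Submodule ℤ N :=
  LinearMap.range (LinearMap.snd ℤ (ℤ × Module.Dual ℤ ℤ) N ∘ₗ V.subtype ∘ₗ
    (LinearMap.ker (LinearMap.snd ℤ ℤ (Module.Dual ℤ ℤ) ∘ₗ
      LinearMap.fst ℤ (ℤ × Module.Dual ℤ ℤ) N ∘ₗ V.subtype)).subtype)

variable {V}

theorem mem_planeReduction {m : N} : m ∈ planeReduction V ↔ ∃ a : ℤ, ((a, 0), m) ∈ V := by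
  constructor
  · rintro ⟨⟨⟨⟨⟨a, b⟩, m⟩, hV⟩, hb⟩, rfl⟩
    obtain rfl : b = 0 := hb
    exact ⟨a, hV⟩
  · rintro ⟨a, ha⟩
    exact ⟨⟨⟨_, ha⟩, rfl⟩, rfl⟩

variable {ε : ℤˣ} {ψ : Q ε N} {v w : (ℤ × Module.Dual ℤ ℤ) × N}

theorem eq_neg_symm_of_mem (hw : w ∈ annihilator (Q.sum (hyperbolic ε ℤ) ψ) V)
    (hw1 : w.1.2 1 = 1) {a : ℤ} {m : N} (ha : ((a, 0), m) ∈ V) : a = -Q.symm ψ w.2 m := by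
  have h := hw _ ha
  rw [Q.symm_sum, symm_hyperbolic, ← mul_one a, ← smul_eq_mul, map_smul, hw1] at h
  simp only [smul_eq_mul, mul_one, LinearMap.zero_apply, mul_zero, add_zero] at h
  linarith

theorem isSummand_planeReduction [Module.Free ℤ N] [Module.Finite ℤ N] (hV : IsSummand V)
    (hw : w ∈ annihilator (Q.sum (hyperbolic ε ℤ) ψ) V) (hw1 : w.1.2 1 = 1) :
    IsSummand (planeReduction V) := by
  refine isSummand_iff_saturated.2 fun c m hc hm => ?_
  obtain ⟨a, ha⟩ := mem_planeReduction.1 hm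
  refine mem_planeReduction.2 ⟨-Q.symm ψ w.2 m, isSummand_iff_saturated.1 hV c _ hc ?_⟩
  convert ha using 1
  rw [eq_neg_symm_of_mem hw hw1 ha]
  simp

theorem finrank_planeReduction [Module.Finite ℤ N]
    (hw : w ∈ annihilator (Q.sum (hyperbolic ε ℤ) ψ) V) (hw1 : w.1.2 1 = 1) (hv : v ∈ V)
    (hv1 : v.1.2 1 = 1) : Module.finrank ℤ V = Module.finrank ℤ (planeReduction V) + 1 := by
  rw [planeReduction, LinearMap.finrank_range_of_inj]
  · have hs : Function.Surjective (LinearMap.snd ℤ ℤ (Module.Dual ℤ ℤ) ∘ₗ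
        LinearMap.fst ℤ (ℤ × Module.Dual ℤ ℤ) N ∘ₗ V.subtype) :=
      fun f => ⟨f 1 • ⟨v, hv⟩, LinearMap.ext_ring (by simp [hv1])⟩
    rw [← Submodule.finrank_quotient_add_finrank,
      (LinearMap.quotKerEquivOfSurjective _ hs).finrank_eq,
      (LinearMap.ringLmapEquivSelf ℤ ℤ ℤ).finrank_eq, Module.finrank_self, add_comm]
  · rw [injective_iff_map_eq_zero]
    rintro ⟨⟨⟨⟨a, b⟩, m⟩, hV⟩, hb⟩ hm
    obtain rfl : b = 0 := hb
    obtain rfl : m = 0 := hm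
    obtain rfl : a = 0 := by simpa using eq_neg_symm_of_mem hw hw1 hV
    rfl

theorem isCompl_hypL_prod (hw : w ∈ annihilator (Q.sum (hyperbolic ε ℤ) ψ) V)
    (hw1 : w.1.2 1 = 1) (hv : v ∈ V) (hv1 : v.1.2 1 = 1) {K : Submodule ℤ N}
    (hK : IsCompl K (planeReduction V)) : IsCompl ((hypL ℤ).prod K) V := by
  constructor
  · rw [Submodule.disjoint_def]
    rintro ⟨⟨a, b⟩, m⟩ ⟨hb, hm⟩ hx
    obtain rfl : b = 0 := mem_hypL.1 hb
    obtain rfl : m = 0 :=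
      Submodule.disjoint_def.1 hK.disjoint m hm (mem_planeReduction.2 ⟨a, hx⟩)
    obtain rfl : a = 0 := by simpa using eq_neg_symm_of_mem hw hw1 hx
    rfl
  · refine Submodule.codisjoint_iff_exists_add_eq.2 fun x => ?_
    obtain ⟨k, m, hk, hm, hkm⟩ :=
      Submodule.codisjoint_iff_exists_add_eq.1 hK.codisjoint (x - x.1.2 1 • v).2
    obtain ⟨a, ha⟩ := mem_planeReduction.1 hm
    refine ⟨((x.1.1 - x.1.2 1 * v.1.1 - a, 0), k), ((a, 0), m) + x.1.2 1 • v,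
      ⟨mem_hypL.2 rfl, hk⟩, V.add_mem ha (V.smul_mem _ hv), ?_⟩
    refine Prod.ext (Prod.ext ?_ (LinearMap.ext_ring ?_)) ?_
    · simp only [Prod.fst_add, Prod.smul_fst, smul_eq_mul]
      ring
    · simp [hv1]
    · rw [Prod.snd_add, Prod.snd_add, ← add_assoc, hkm]
      simp

end PlaneReduction

section Complement

variable {M : Type} [AddCommGroup M] [Module.Free ℤ M] [Module.Finite ℤ M] {ψ : Q (-1) M}
  {L V : Submodule ℤ M}

theorem IsLagrangian.exists_plane_splitting_both (hL : IsLagrangian ψ L) (hψ : Nonsingular ψ)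
    (hV : IsSummand V) (hV0 : V ≠ ⊥) (hW0 : annihilator ψ V ≠ ⊥) :
    ∃ (N : Form (-1)) (J : Submodule ℤ N.carrier)
      (φ : ((ℤ × Module.Dual ℤ ℤ) × N.carrier) ≃ₗ[ℤ] M),
      Nonsingular N.θ ∧ IsLagrangian N.θ J ∧
      Q.pullback φ.toLinearMap ψ = Q.sum (hyperbolic (-1) ℤ) N.θ ∧
      (∃ v ∈ V, (φ.symm v).1.2 1 = 1) ∧ ∃ w ∈ annihilator ψ V, (φ.symm w).1.2 1 = 1 := by
  obtain ⟨e, hqe, ⟨v, hv, hev⟩, w, hw, hew⟩ := hL.exists_dual_on_both hψ hV hV0 hW0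
  have he : Primitive e := ⟨(Q.symm ψ).flip v, hev⟩
  obtain ⟨J, hJ, heJ, -⟩ := exists_isLagrangian_mem_isNull hψ hL he hqe
  obtain ⟨N, φ, hN, hφ, rfl⟩ := hψ.exists_plane_splitting he hqe
  obtain ⟨J₁, hJ₁, -⟩ := hJ.exists_map_hypL_prod_eq hφ heJ
  have hsymm (x : M) : Q.symm ψ (φ ((1, 0), 0)) x = (φ.symm (-x)).1.2 1 := by
    have h := Q.symm_pullback φ.toLinearMap ψ ((1, 0), 0) (φ.symm x)
    rw [hφ] at h
    simpa [symm_hyperbolic] using h.symm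
  exact ⟨N, J₁, φ, hN, hJ₁, hφ, ⟨-v, V.neg_mem hv, (hsymm v).symm.trans hev⟩,
    -w, Submodule.neg_mem _ hw, (hsymm w).symm.trans hew⟩

end Complement

theorem exists_isLagrangian_isCompl {M : Type} [AddCommGroup M] [Module.Free ℤ M]
    [Module.Finite ℤ M] {ψ : Q (-1) M} {L V : Submodule ℤ M} (hψ : Nonsingular ψ)
    (hL : IsLagrangian ψ L) (hV : IsSummand V)
    (hrank : 2 * Module.finrank ℤ V = Module.finrank ℤ M) :
    ∃ K, IsLagrangian ψ K ∧ IsCompl K V := by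
  have hW := hψ.finrank_add_finrank_annihilator hV
  by_cases hV0 : V = ⊥
  · have : Subsingleton M := Module.finrank_zero_iff.1 (by rw [← hrank, hV0, finrank_bot])
    exact ⟨L, hL, by rw [hV0, Subsingleton.elim L ⊤]; exact isCompl_top_bot⟩
  have hW0 : annihilator ψ V ≠ ⊥ := fun h => hV0 (Submodule.finrank_eq_zero.1 (by
    rw [h, finrank_bot] at hW
    omega))
  obtain ⟨N, J, φ, hN, hJ, hφ, ⟨v, hv, hv1⟩, w, hw, hw1⟩ :=
    hL.exists_plane_splitting_both hψ hV hV0 hW0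
  obtain ⟨U, rfl⟩ : ∃ U : Submodule ℤ _, V = U.map φ.toLinearMap :=
    ⟨_, (Submodule.map_comap_eq_of_surjective φ.surjective V).symm⟩
  have hU : IsSummand U := by
    simpa [Submodule.comap_map_eq_of_injective φ.injective] using hV.comap φ
  rw [annihilator_map, hφ, Submodule.mem_map_equiv] at hw
  rw [Submodule.mem_map_equiv] at hv
  have hUrank := finrank_planeReduction hw hw1 hv hv1
  have hM : Module.finrank ℤ M = Module.finrank ℤ N.carrier + 2 := by
    rw [← φ.finrank_eq, Module.finrank_prod, finrank_hyp, Module.finrank_self]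
    omega
  rw [LinearEquiv.finrank_map_eq φ U] at hrank
  obtain ⟨K, hK, hKU⟩ := exists_isLagrangian_isCompl hN hJ
    (isSummand_planeReduction hU hw hw1) (by omega)
  exact ⟨((hypL ℤ).prod K).map φ.toLinearMap, .map φ (hφ ▸ hypL_lagrangian.prod hK),
    (Submodule.orderIsoMapComap φ).isCompl (isCompl_hypL_prod hw hw1 hv hv1 hKU)⟩
termination_by Module.finrank ℤ M

/-! ### Classification of quasi-formations by the form on `V` -/

namespace QuasiFormation

theorem toL_eq_of_isometry {x y : QuasiFormation (-1)} (f : x.M ≃ₗ[ℤ] y.M)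
    (hf : Q.pullback f.toLinearMap y.ψ = x.ψ) (hV : x.V.map f.toLinearMap = y.V) :
    x.toL = y.toL := by
  have hK : IsLagrangian y.ψ (x.L.map f.toLinearMap) := .map f (hf ▸ x.lagrangian)
  rw [← (isNull_of_isLagrangian y.nonsingular hK y.lagrangian).toL_replaceL hK]
  exact Iso.toL_eq ⟨f, hf, rfl, hV⟩

theorem toL_boundary_eq (x : QuasiFormation (-1)) {ρ : BilinForm ℤ x.V}
    (hρ : Q.mk (-1) ρ = Q.pullback x.V.subtype x.ψ) : (boundary (-1) x.V ρ).toL = x.toL := by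
  obtain ⟨J, hJ, hJV⟩ :=
    exists_isLagrangian_isCompl x.nonsingular x.lagrangian x.summand x.half_rank
  obtain ⟨f, hf, hfV, -⟩ := hJ.exists_isometry_hyperbolic x.nonsingular hJV.symm hρ
  exact (toL_eq_of_isometry (y := boundary (-1) x.V ρ) f hf hfV).symm

theorem toL_eq_of_isometric_formV {x y : QuasiFormation (-1)}
    (h : Form.Isometric x.formV y.formV) : x.toL = y.toL := by
  obtain ⟨f, hf⟩ := h
  change x.V ≃ₗ[ℤ] y.V at f
  change Q.pullback f.toLinearMap (Q.pullback y.V.subtype y.ψ) = Q.pullback x.V.subtype x.ψ at hf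
  obtain ⟨ρ, hρ⟩ := Q.mk_surjective (Q.pullback y.V.subtype y.ψ)
  rw [← hρ, Q.pullback_mk] at hf
  exact (x.toL_boundary_eq hf).symm.trans ((boundary_iso f ρ).toL_eq.trans (y.toL_boundary_eq hρ))

variable {ε : ℤˣ} (x : QuasiFormation ε) (P : Type) [AddCommGroup P] [Module.Free ℤ P]
  [Module.Finite ℤ P]

theorem isometric_formV_sum_trivialFormation :
    Form.Isometric (x.sum (trivialFormation ε P)).formV (x.formV.sum (Form.zero ε P)) := by
  have hrank : Module.finrank ℤ (hypR P) = Module.finrank ℤ P := by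
    have h := (hypR_lagrangian (ε := ε) (P := P)).half_rank hyperbolic_nonsingular
    rw [finrank_hyp] at h
    omega
  let f : hypR P ≃ₗ[ℤ] P := LinearEquiv.ofFinrankEq (hypR P) P hrank
  refine (restrict_prod x.ψ _ x.V _).trans (.sum (.refl _) ⟨f, ?_⟩)
  exact (map_zero _).trans (hypR_lagrangian (ε := ε) (P := P)).pullback_eq.symm

theorem toL_sum_trivialFormation : (x.sum (trivialFormation ε P)).toL = x.toL := by
  rw [toL_sum, toL_trivialFormation]
  exact LMonoid.add_zero _

theorem toL_eq_of_toFZS_formV {x y : QuasiFormation (-1)}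
    (h : x.formV.toFZS = y.formV.toFZS) : x.toL = y.toL := by
  obtain ⟨P, P', _, _, _, _, _, _, h⟩ := (AddCon.eq _).1 h
  have h' : Form.Isometric (x.formV.sum (Form.zero (-1) P)) (y.formV.sum (Form.zero (-1) P')) :=
    Quotient.exact h
  rw [← x.toL_sum_trivialFormation P, ← y.toL_sum_trivialFormation P']
  exact toL_eq_of_isometric_formV (((x.isometric_formV_sum_trivialFormation P).trans h').trans
    (y.isometric_formV_sum_trivialFormation P').symm)

end QuasiFormation

theorem LMonoid.exists_toL {ε : ℤˣ} (a : LMonoid ε) : ∃ x : QuasiFormation ε, x.toL = a := by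
  induction a using AddCon.induction_on with
  | _ a =>
    induction a using AddCon.induction_on with
    | _ a =>
      obtain ⟨x, rfl⟩ := Quotient.exists_rep a
      exact ⟨x, rfl⟩

theorem FZS.exists_toFZS {ε : ℤˣ} (a : FZS ε) : ∃ v : Form ε, v.toFZS = a := by
  induction a using AddCon.induction_on with
  | _ a =>
    obtain ⟨v, rfl⟩ := Quotient.exists_rep a
    exact ⟨v, rfl⟩

theorem LMonoid.isElementary (a : LMonoid (-1)) : IsElementary a := by
  obtain ⟨x, rfl⟩ := a.exists_toL
  obtain ⟨ρ, hρ⟩ := Q.mk_surjective (Q.pullback x.V.subtype x.ψ)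
  exact ⟨x.V, _, _, _, ρ, x.toL_boundary_eq hρ⟩

theorem bijective_fst_b : Function.Bijective fun a : LMonoid (-1) => (b (-1) a).1 := by
  constructor
  · intro a a' h
    obtain ⟨x, rfl⟩ := a.exists_toL
    obtain ⟨x', rfl⟩ := a'.exists_toL
    exact QuasiFormation.toL_eq_of_toFZS_formV h
  · intro v
    obtain ⟨⟨K, θ⟩, rfl⟩ := v.exists_toFZS
    obtain ⟨ρ, rfl⟩ := Q.mk_surjective θ
    exact ⟨(QuasiFormation.boundary (-1) K ρ).toL,
      congrArg Prod.fst (QuasiFormation.b_toL_boundary ρ)⟩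

theorem snd_b (a : LMonoid (-1)) : (b (-1) a).2 = (b (-1) a).1 := by
  obtain ⟨K, _, _, _, ρ, rfl⟩ := a.isElementary
  rw [QuasiFormation.b_toL_boundary]

end

end Surgery

theorem mainTheorem10 :
    (∀ x : Surgery.LMonoid (-1), Surgery.IsElementary x) ∧
    (∃ e : Surgery.LMonoid (-1) ≃+ Surgery.FZS (-1), ∀ x : Surgery.LMonoid (-1),
      Surgery.b (-1) x = (e x, e x)) := by
  refine ⟨Surgery.LMonoid.isElementary, ?_⟩
  exact ⟨AddEquiv.ofBijective
    ((AddMonoidHom.fst (Surgery.FZS (-1)) (Surgery.FZS (-1))).comp (Surgery.b (-1)))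
    Surgery.bijective_fst_b, fun x => Prod.ext rfl (Surgery.snd_b x)⟩
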